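/- Let $\mathbb{C}_+=\{s\in\mathbb{C}:\operatorname{Re}s>0\}$ and let $\mathcal{A}(\mathbb{C}_+)$ be the space of all functions $f:\mathbb{C}_+\to\mathbb{C}$ that are uniformly continuous on $\mathbb{C}_+$ and for which there is a Dirichlet series $\sum_{n\ge1}a_nn^{-s}$ that converges to $f(s)$ at every point $s\in\mathbb{C}_+$, normed by $\|f\|_\infty=\sup_{s\in\mathbb{C}_+}|f(s)|$. Let $B_{c_0}$ be the open unit ball of the space $c_0$ of complex null sequences (with the supremum norm), and let $\mathcal{A}_u(B_{c_0})$ be the space of all functions $g:B_{c_0}\to\mathbb{C}$ that are uniformly continuous and complex Fréchet differentiable on $B_{c_0}$, normed by $\|g\|_{B_{c_0}}=\sup_{z\in B_{c_0}}|g(z)|$. (The functions in both spaces are bounded, so these are finite norms.) Let $p_1<p_2<\cdots$ be the primes, and for a finitely supported sequence $\alpha=(\alpha_1,\alpha_2,\dots)$ of non-negative integers put $p^\alpha=\prod_jp_j^{\alpha_j}$ and $z^\alpha=\prod_jz_j^{\alpha_j}$. Then there is a surjective $\mathbb{C}$-linear isometry $\Phi:\mathcal{A}(\mathbb{C}_+)\to\mathcal{A}_u(B_{c_0})$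 such that 1. for all $f,g\in\mathcal{A}(\mathbb{C}_+)$ the product $fg$ lies in $\mathcal{A}(\mathbb{C}_+)$ and $\Phi(fg)=\Phi(f)\Phi(g)$; 2. for every $\alpha$, with $n=p^\alpha$, the function $s\mapsto n^{-s}$ lies in $\mathcal{A}(\mathbb{C}_+)$ and $\Phi$ maps it to the monomial $z\mapsto z^\alpha$. -/

import Mathlib

open Filter Topology
open scoped ZeroAtInfty

namespace BohrLift

/-- The supremum norm on a linear space of bounded complex functions. -/
noncomputable def supNorm {X : Type*} [Nonempty X] (S : Submodule ℂ (X → ℂ))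
    (hS : ∀ f ∈ S, BddAbove (Set.range fun x => ‖f x‖)) : AddGroupNorm S where
  toFun f := ⨆ x, ‖f.1 x‖
  map_zero' := by simp
  add_le' f g := by
    refine ciSup_le fun x => ?_
    exact (norm_add_le _ _).trans
      (add_le_add (le_ciSup (hS f.1 f.2) x) (le_ciSup (hS g.1 g.2) x))
  neg' f := by simp
  eq_zero_of_map_eq_zero' f hf := by
    ext x
    have h1 : ‖f.1 x‖ ≤ ⨆ x, ‖f.1 x‖ := le_ciSup (hS f.1 f.2) x
    rw [hf] at h1
    simpa using h1

theorem supNorm_smul_le {X : Type*} [Nonempty X] (S : Submodule ℂ (X → ℂ))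
    (hS : ∀ f ∈ S, BddAbove (Set.range fun x => ‖f x‖)) (c : ℂ) (f : S) :
    supNorm S hS (c • f) ≤ ‖c‖ * supNorm S hS f := by
  change (⨆ x, ‖(c • f).1 x‖) ≤ ‖c‖ * ⨆ x, ‖f.1 x‖
  refine ciSup_le fun x => ?_
  have h1 : ‖f.1 x‖ ≤ ⨆ x, ‖f.1 x‖ := le_ciSup (hS f.1 f.2) x
  calc ‖(c • f).1 x‖ = ‖c‖ * ‖f.1 x‖ := by simp
    _ ≤ _ := mul_le_mul_of_nonneg_left h1 (norm_nonneg c)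

/-! ### Uniformly continuous Dirichlet series on the half-plane -/

/-- The open right half-plane `ℂ₊`. -/
abbrev HalfPlane : Type := {s : ℂ // 0 < s.re}

instance : Nonempty HalfPlane := ⟨⟨1, by simp⟩⟩

/-- `f` is the pointwise sum on `ℂ₊` of the Dirichlet series with coefficients `a 1, a 2, …`
(convergence of partial sums, not necessarily absolute). -/
def HasDirichletSeries (a : ℕ → ℂ) (f : HalfPlane → ℂ) : Prop :=
  ∀ s : HalfPlane,
    Tendsto (fun N : ℕ => ∑ n ∈ Finset.Icc 1 N, a n * (n : ℂ) ^ (-(s : ℂ))) atTop (𝓝 (f s))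

/-- The functions on `ℂ₊` that are sums of a Dirichlet series converging on `ℂ₊` and are
uniformly continuous there. -/
def dirichletSubmodule : Submodule ℂ (HalfPlane → ℂ) where
  carrier := {f | (∃ a : ℕ → ℂ, HasDirichletSeries a f) ∧ UniformContinuous f}
  zero_mem' := ⟨⟨0, fun s => by simp⟩, uniformContinuous_const⟩
  add_mem' := by
    rintro f g ⟨⟨a, ha⟩, hf⟩ ⟨⟨b, hb⟩, hg⟩
    refine ⟨⟨a + b, fun s => ?_⟩, hf.add hg⟩
    have := (ha s).add (hb s)
    simpa [add_mul, Finset.sum_add_distrib] using this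
  smul_mem' := by
    rintro c f ⟨⟨a, ha⟩, hf⟩
    refine ⟨⟨c • a, fun s => ?_⟩, hf.const_smul c⟩
    have := (ha s).const_mul c
    simpa [Finset.mul_sum, mul_assoc] using this

theorem bounded_of_mem_dirichletSubmodule (f : HalfPlane → ℂ) (hf : f ∈ dirichletSubmodule) :
    BddAbove (Set.range fun s => ‖f s‖) := by
  obtain ⟨⟨a, ha⟩, hu⟩ := hf
  obtain ⟨M, hM⟩ : ∃ M : ℝ, ∀ s : HalfPlane, 2 ≤ (s : ℂ).re → ‖f s‖ ≤ M := by
    have h0 := ha ⟨(1 / 2 : ℝ), by rw [Complex.ofReal_re]; norm_num⟩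
    obtain ⟨C, hC⟩ := h0.norm.bddAbove_range
    have hb : ∀ n : ℕ, 1 ≤ n → ‖a n‖ * (n : ℝ) ^ (-(1 / 2) : ℝ) ≤ 2 * C := by
      intro n hn
      obtain ⟨m, rfl⟩ : ∃ m, n = m + 1 := ⟨n - 1, by omega⟩
      have h1 := hC ⟨m, rfl⟩
      have h2 := hC ⟨m + 1, rfl⟩
      have h3 : ‖a (m + 1) * ((m + 1 : ℕ) : ℂ) ^ (-((1 / 2 : ℝ) : ℂ))‖
          = ‖a (m + 1)‖ * ((m + 1 : ℕ) : ℝ) ^ (-(1 / 2) : ℝ) := by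
        rw [norm_mul, Complex.norm_natCast_cpow_of_pos (Nat.succ_pos m)]
        simp
      rw [← h3]
      beta_reduce at h1 h2
      rw [Finset.sum_Icc_succ_top (Nat.le_add_left 1 m)] at h2
      have h4 := norm_le_add_norm_add' (∑ n ∈ Finset.Icc 1 m, a n * (n : ℂ) ^ (-((1 / 2 : ℝ) : ℂ)))
        (a (m + 1) * ((m + 1 : ℕ) : ℂ) ^ (-((1 / 2 : ℝ) : ℂ)))
      linarith
    have hsum : Summable fun n : ℕ => (2 * C) * (n : ℝ) ^ (-(3 / 2) : ℝ) :=
      (Real.summable_nat_rpow.2 (by norm_num)).mul_left _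
    refine ⟨∑' n : ℕ, (2 * C) * (n : ℝ) ^ (-(3 / 2) : ℝ), fun s hs => ?_⟩
    have hC0 : 0 ≤ C := (norm_nonneg _).trans (hC ⟨0, rfl⟩)
    refine le_of_tendsto (ha s).norm (Eventually.of_forall fun N => ?_)
    refine (norm_sum_le _ _).trans ((Finset.sum_le_sum fun n hn => ?_).trans
      (hsum.sum_le_tsum (Finset.Icc 1 N) fun n _ => by positivity))
    have hn1 : 1 ≤ n := (Finset.mem_Icc.1 hn).1
    have hn0 : (1 : ℝ) ≤ n := by exact_mod_cast hn1
    rw [norm_mul, Complex.norm_natCast_cpow_of_pos hn1]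
    calc ‖a n‖ * (n : ℝ) ^ (-(s : ℂ)).re
        ≤ ‖a n‖ * (n : ℝ) ^ (-(1 / 2) + -(3 / 2) : ℝ) := by
          refine mul_le_mul_of_nonneg_left (Real.rpow_le_rpow_of_exponent_le hn0 ?_)
            (norm_nonneg _)
          simp only [Complex.neg_re]
          linarith
      _ = (‖a n‖ * (n : ℝ) ^ (-(1 / 2) : ℝ)) * (n : ℝ) ^ (-(3 / 2) : ℝ) := by
          rw [Real.rpow_add (by linarith), mul_assoc]
      _ ≤ _ := mul_le_mul_of_nonneg_right (hb n hn1) (by positivity)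
  obtain ⟨δ, hδ, hfδ⟩ := Metric.uniformContinuous_iff.1 hu 1 one_pos
  obtain ⟨k, hk⟩ := exists_nat_gt (2 / (δ / 2))
  have hkδ : 2 ≤ (k : ℝ) * (δ / 2) := by
    rw [div_lt_iff₀ (by positivity)] at hk
    exact hk.le
  have hstep : ∀ j : ℕ, ∀ s : HalfPlane, 2 ≤ (s : ℂ).re + j * (δ / 2) → ‖f s‖ ≤ M + j := by
    intro j
    induction j with
    | zero => intro s hs; simpa using hM s (by simpa using hs)
    | succ j ih =>
      intro s hs
      have hre : ((s : ℂ) + ((δ / 2 : ℝ) : ℂ)).re = (s : ℂ).re + δ / 2 := by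
        rw [Complex.add_re, Complex.ofReal_re]
      let t : HalfPlane := ⟨(s : ℂ) + ((δ / 2 : ℝ) : ℂ), by
        rw [hre]; have := s.2; positivity⟩
      have h1 : ‖f t‖ ≤ M + j := ih t (by
        change 2 ≤ ((s : ℂ) + ((δ / 2 : ℝ) : ℂ)).re + j * (δ / 2)
        rw [hre]; push_cast at hs; linarith)
      have h2 : dist (f s) (f t) < 1 := hfδ (by
        rw [Subtype.dist_eq, dist_eq_norm]
        change ‖(s : ℂ) - ((s : ℂ) + ((δ / 2 : ℝ) : ℂ))‖ < δ
        rw [sub_add_cancel_left, norm_neg, Complex.norm_real, Real.norm_eq_abs,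
          abs_of_pos (by positivity)]
        linarith)
      rw [dist_eq_norm] at h2
      have h3 := norm_le_norm_add_norm_sub' (f s) (f t)
      push_cast
      linarith
  refine ⟨M + k, ?_⟩
  rintro _ ⟨s, rfl⟩
  exact hstep k s (by have := s.2; linarith)

/-- The space `𝒜(ℂ₊)`. -/
def DirichletAlgebra : Type := dirichletSubmodule

namespace DirichletAlgebra

instance : AddCommGroup DirichletAlgebra := inferInstanceAs (AddCommGroup dirichletSubmodule)

instance : Module ℂ DirichletAlgebra := inferInstanceAs (Module ℂ dirichletSubmodule)

instance : FunLike DirichletAlgebra HalfPlane ℂ where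
  coe f := f.1
  coe_injective := Subtype.val_injective

/-- The norm is `‖f‖ = sup {‖f s‖ : s ∈ ℂ₊}`. -/
noncomputable instance : NormedAddCommGroup DirichletAlgebra :=
  AddGroupNorm.toNormedAddCommGroup (E := DirichletAlgebra)
    (supNorm dirichletSubmodule bounded_of_mem_dirichletSubmodule)

noncomputable instance : NormedSpace ℂ DirichletAlgebra where
  norm_smul_le := supNorm_smul_le dirichletSubmodule bounded_of_mem_dirichletSubmodule

theorem norm_def (f : DirichletAlgebra) : ‖f‖ = ⨆ s : HalfPlane, ‖f s‖ := rfl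

end DirichletAlgebra

/-! ### Uniformly continuous holomorphic functions on the ball of `c₀` -/

/-- The open unit ball of `c₀`, the null sequences with the supremum norm. -/
abbrev BallC0 : Type := Metric.ball (0 : C₀(ℕ, ℂ)) 1

instance : Nonempty BallC0 := ⟨⟨0, by simp⟩⟩

/-- The functions on the open unit ball of `c₀` that are uniformly continuous and complex
Fréchet differentiable. -/
def ballSubmodule : Submodule ℂ (BallC0 → ℂ) where
  carrier := {f | UniformContinuous f ∧ ∃ F : C₀(ℕ, ℂ) → ℂ,
    DifferentiableOn ℂ F (Metric.ball 0 1) ∧ ∀ z : BallC0, f z = F z}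
  zero_mem' := ⟨uniformContinuous_const, 0, differentiableOn_const 0, fun _ => rfl⟩
  add_mem' := by
    rintro f g ⟨hf, F, hF, hfF⟩ ⟨hg, G, hG, hgG⟩
    exact ⟨hf.add hg, F + G, hF.add hG, fun z => by simp [hfF, hgG]⟩
  smul_mem' := by
    rintro c f ⟨hf, F, hF, hfF⟩
    exact ⟨hf.const_smul c, c • F, hF.const_smul c, fun z => by simp [hfF]⟩

theorem bounded_of_mem_ballSubmodule (f : BallC0 → ℂ) (hf : f ∈ ballSubmodule) :
    BddAbove (Set.range fun z => ‖f z‖) := by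
  obtain ⟨δ, hδ, hfδ⟩ := Metric.uniformContinuous_iff.1 hf.1 1 one_pos
  obtain ⟨k, hk⟩ := exists_nat_gt (1 / δ)
  have hkδ : 1 < (k : ℝ) * δ := (div_lt_iff₀ hδ).1 hk
  have hstep : ∀ j : ℕ, ∀ z : BallC0, ‖(z : C₀(ℕ, ℂ))‖ ≤ j / k →
      ‖f z‖ ≤ ‖f ⟨0, by simp⟩‖ + j := by
    have hk0 : (0 : ℝ) < k := lt_trans (by positivity) hk
    intro j
    induction j with
    | zero =>
      intro z hz
      have hz0 : (z : C₀(ℕ, ℂ)) = 0 := by simpa using hz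
      have : z = ⟨0, by simp⟩ := Subtype.ext hz0
      simp [this]
    | succ j ih =>
      intro z hz
      have hj : (0 : ℝ) < j + 1 := by positivity
      have hz1 : ‖(z : C₀(ℕ, ℂ))‖ < 1 := mem_ball_zero_iff.1 z.2
      let c : ℝ := j / (j + 1)
      have hc0 : 0 ≤ c := by positivity
      have hc1 : 1 - c = 1 / (j + 1) := by simp only [c]; field_simp; ring
      have hcle : c ≤ 1 := by
        have : 0 < 1 - c := by rw [hc1]; positivity
        linarith
      have hnorm : ‖(c : ℂ) • (z : C₀(ℕ, ℂ))‖ = c * ‖(z : C₀(ℕ, ℂ))‖ := by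
        rw [norm_smul, Complex.norm_real, Real.norm_of_nonneg hc0]
      let w : BallC0 := ⟨(c : ℂ) • (z : C₀(ℕ, ℂ)), by
        rw [mem_ball_zero_iff, hnorm]
        exact (mul_le_of_le_one_left (norm_nonneg _) hcle).trans_lt hz1⟩
      push_cast at hz
      have h1 : ‖f w‖ ≤ ‖f ⟨0, by simp⟩‖ + j := ih w (by
        change ‖(c : ℂ) • (z : C₀(ℕ, ℂ))‖ ≤ j / k
        rw [hnorm]
        calc c * ‖(z : C₀(ℕ, ℂ))‖ ≤ c * ((j + 1) / k) := mul_le_mul_of_nonneg_left hz hc0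
          _ = j / k := by simp only [c]; field_simp)
      have h2 : dist (f z) (f w) < 1 := hfδ (by
        rw [Subtype.dist_eq, dist_eq_norm]
        change ‖(z : C₀(ℕ, ℂ)) - (c : ℂ) • (z : C₀(ℕ, ℂ))‖ < δ
        have : (z : C₀(ℕ, ℂ)) - (c : ℂ) • (z : C₀(ℕ, ℂ))
            = ((1 - c : ℝ) : ℂ) • (z : C₀(ℕ, ℂ)) := by
          ext i; simp; ring
        rw [this, norm_smul, Complex.norm_real, Real.norm_of_nonneg (by linarith), hc1]
        calc 1 / ((j : ℝ) + 1) * ‖(z : C₀(ℕ, ℂ))‖ ≤ 1 / ((j : ℝ) + 1) * ((j + 1) / k) :=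
              mul_le_mul_of_nonneg_left hz (by positivity)
          _ = 1 / k := by field_simp
          _ < δ := by rw [div_lt_iff₀ hk0]; linarith)
      rw [dist_eq_norm] at h2
      have h3 := norm_le_norm_add_norm_sub' (f z) (f w)
      push_cast
      linarith
  refine ⟨‖f ⟨0, by simp⟩‖ + k, ?_⟩
  rintro _ ⟨z, rfl⟩
  have hk0 : (k : ℝ) ≠ 0 := by rintro h; rw [h] at hkδ; linarith
  have hz1 : ‖(z : C₀(ℕ, ℂ))‖ < 1 := mem_ball_zero_iff.1 z.2
  exact hstep k z (by rw [div_self hk0]; exact hz1.le)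

/-- The space `𝒜ᵤ(B_{c₀})`. -/
def BallAlgebra : Type := ballSubmodule

namespace BallAlgebra

instance : AddCommGroup BallAlgebra := inferInstanceAs (AddCommGroup ballSubmodule)

instance : Module ℂ BallAlgebra := inferInstanceAs (Module ℂ ballSubmodule)

instance : FunLike BallAlgebra BallC0 ℂ where
  coe f := f.1
  coe_injective := Subtype.val_injective

/-- The norm is `‖f‖ = sup {‖f z‖ : z ∈ B_{c₀}}`. -/
noncomputable instance : NormedAddCommGroup BallAlgebra :=
  AddGroupNorm.toNormedAddCommGroup (E := BallAlgebra)
    (supNorm ballSubmodule bounded_of_mem_ballSubmodule)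

noncomputable instance : NormedSpace ℂ BallAlgebra where
  norm_smul_le := supNorm_smul_le ballSubmodule bounded_of_mem_ballSubmodule

theorem norm_def (f : BallAlgebra) : ‖f‖ = ⨆ z : BallC0, ‖f z‖ := rfl

end BallAlgebra

/-! ### Multi-indices -/

/-- `p ^ α = ∏ p_j ^ α_j`, where `p_0 < p_1 < …` are the primes. -/
noncomputable def primePow (α : ℕ →₀ ℕ) : ℕ := α.prod fun j k => Nat.nth Nat.Prime j ^ k

/-- The monomial `z ^ α = ∏ z_j ^ α_j`. -/
noncomputable def monomial (α : ℕ →₀ ℕ) (z : BallC0) : ℂ :=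
  α.prod fun j k => (z : C₀(ℕ, ℂ)) j ^ k

end BohrLift

namespace BohrLift

open MeasureTheory

/-! ### Entire functions of polynomial growth on normed spaces -/

/-! Both spaces are completions of one normed algebra, the polynomials in the variables `z 0, z 1,
…`. A polynomial `p` is read as a function on the ball, and, after substituting the `j`-th prime to
the power `-s` for `z j`, as a Dirichlet polynomial; unique factorization matches monomials with
integers. Three facts then suffice: the two supremum norms of `p` agree (`norm_ofPolynomial_eq`),
polynomials are dense on each side, and uniform limits of polynomials stay in each space. The
isometry between polynomials extends to the completions, and multiplicativity passes to the limit.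

Norms. The vector of prime powers is a coordinatewise limit of its truncations, which lie in the
ball; this gives one inequality. For the other, the coefficients of a Dirichlet polynomial are at
most a universal constant times its supremum. Applying this to `p ^ k`, summing a geometric series
in each variable and taking `k`-th roots removes the constant (`norm_eval_le_of_halfPlane`).

Density on the ball. Dilating and cutting off the Taylor series leaves homogeneous terms, which are
entire on complex lines and of polynomial growth (`PolyGrowth`). A gliding-hump argument special to
the sup norm shows that such functions depend on finitely many coordinates up to a uniformly small
error (`PolyGrowth.almostFinite`), and on finitely many coordinates they are polynomials.

Density on the half-plane. Averaging along vertical lines against a kernel with compactly supported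
Fourier transform replaces `f` by a Dirichlet polynomial, uniformly close by uniform continuity
(`exists_eval_primeVec_near`).

Closedness. On the ball, Cauchy estimates carry uniform convergence over to Fréchet derivatives. On
the half-plane the limiting Dirichlet series must be shown to converge pointwise. This follows from
a bound for all partial sums at a point by the supremum of the whole polynomial
(`exists_norm_dirichletSum_le`). -/

theorem norm_sub_le_of_entire {φ : ℂ → ℂ} (hφ : Differentiable ℂ φ) {M ρ : ℝ} (hρ : 1 ≤ ρ)
    (hM : ∀ z : ℂ, ‖z‖ ≤ ρ → ‖φ z‖ ≤ M) : ‖φ 1 - φ 0‖ ≤ 4 * M / ρ := by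
  have hM0 : 0 ≤ M := (norm_nonneg _).trans (hM 0 (by simpa using zero_le_one.trans hρ))
  rcases le_or_gt 2 ρ with h2 | h2
  · have hd : ∀ z ∈ Metric.closedBall (0 : ℂ) 1, ‖deriv φ z‖ ≤ M / (ρ - 1) := by
      intro z hz
      refine Complex.norm_deriv_le_of_forall_mem_sphere_norm_le (by linarith)
        hφ.diffContOnCl fun w hw => hM w ?_
      have h1 := norm_le_norm_add_norm_sub z w
      rw [mem_sphere_iff_norm] at hw
      rw [mem_closedBall_zero_iff] at hz
      rw [norm_sub_rev] at h1
      linarith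
    have h := (convex_closedBall (0 : ℂ) 1).norm_image_sub_le_of_norm_deriv_le
      (fun z _ => hφ z) hd (x := 0) (y := 1) (by simp) (by simp)
    simp only [sub_zero, norm_one, mul_one] at h
    refine h.trans ?_
    rw [div_le_div_iff₀ (by linarith) (by linarith)]
    nlinarith
  -- For `ρ < 2` the trivial bound `2 * M` is already below `4 * M / ρ`.
  · have h := norm_sub_le (φ 1) (φ 0)
    have h1 := hM 1 (by simpa using hρ)
    have h0 := hM 0 (by simpa using zero_le_one.trans hρ)
    rw [le_div_iff₀ (by linarith)]
    nlinarith [norm_nonneg (φ 1 - φ 0)]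

/-- A function on a complex normed space that is entire on every complex line and grows at most
like `‖z‖ ^ m`. -/
structure PolyGrowth {E : Type*} [NormedAddCommGroup E] [NormedSpace ℂ E] (m : ℕ) (P : E → ℂ) :
    Prop where
  entire : ∀ z u : E, Differentiable ℂ fun c : ℂ => P (z + c • u)
  growth : ∃ C : ℝ, ∀ z, ‖P z‖ ≤ C * (1 + ‖z‖) ^ m

namespace PolyGrowth

variable {E : Type*} [NormedAddCommGroup E] [NormedSpace ℂ E] {m : ℕ} {P : E → ℂ}

theorem growth_pos (hP : PolyGrowth m P) : ∃ C : ℝ, 0 < C ∧ ∀ z, ‖P z‖ ≤ C * (1 + ‖z‖) ^ m := by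
  obtain ⟨C, hC⟩ := hP.growth
  refine ⟨max C 1, by positivity, fun z => (hC z).trans ?_⟩
  gcongr
  exact le_max_left _ _

theorem bounded (hP : PolyGrowth m P) (R : ℝ) : ∃ M : ℝ, 0 < M ∧ ∀ z, ‖z‖ ≤ R → ‖P z‖ ≤ M := by
  obtain ⟨C, hC0, hC⟩ := hP.growth_pos
  refine ⟨C * (1 + |R|) ^ m, by positivity, fun z hz => (hC z).trans ?_⟩
  gcongr
  exact hz.trans (le_abs_self R)

theorem translate (hP : PolyGrowth m P) (u : E) : PolyGrowth m fun z => P (z + u) := by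
  obtain ⟨C, hC0, hC⟩ := hP.growth_pos
  refine ⟨fun z v => ?_, C * (1 + ‖u‖) ^ m, fun z => (hC _).trans ?_⟩
  · simpa only [add_right_comm] using hP.entire (z + u) v
  · rw [mul_assoc, ← mul_pow]
    gcongr
    nlinarith [norm_add_le z u, norm_nonneg z, norm_nonneg u]

/-- On the complex line through `w` and `z`, the parameters of modulus at most `1 / ‖z - w‖` stay in
the ball of radius `R + 1`, so the one-variable estimate applies to close points. For points more
than `1` apart boundedness is enough. -/
theorem lipschitz (hP : PolyGrowth m P) (R : ℝ) : ∃ L : ℝ, 0 < L ∧ ∀ z w : E,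
    ‖z‖ ≤ R → ‖w‖ ≤ R → ‖P z - P w‖ ≤ L * ‖z - w‖ := by
  obtain ⟨M, hM0, hM⟩ := hP.bounded (R + 1)
  refine ⟨4 * M, by positivity, fun z w hz hw => ?_⟩
  rcases eq_or_ne z w with rfl | hzw
  · simp
  have hd : 0 < ‖z - w‖ := norm_pos_iff.2 (sub_ne_zero.2 hzw)
  rcases le_or_gt ‖z - w‖ 1 with h1 | h1
  · have h := norm_sub_le_of_entire (hP.entire w (z - w)) (ρ := 1 / ‖z - w‖) (M := M)
      (by rwa [le_div_iff₀ hd, one_mul]) fun c hc => hM _ ?_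
    · simpa [mul_div_assoc] using h
    · have h2 := norm_add_le w (c • (z - w))
      rw [norm_smul] at h2
      rw [le_div_iff₀ hd] at hc
      linarith
  · have h := norm_sub_le (P z) (P w)
    have := hM z (by linarith)
    have := hM w (by linarith)
    nlinarith

/-- A finite difference lowers the degree, which permits induction on `m`. For `‖z‖ ≥ ‖u‖` the
one-variable estimate with `ρ = (1 + ‖z‖) / (1 + ‖u‖)` gains a factor of order `1 / (1 + ‖z‖)`,
since `1 + ‖z + c • u‖` stays below `2 * (1 + ‖z‖)` on that disc. For smaller `z` a bound depending
on `u` alone suffices. -/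
theorem difference (hP : PolyGrowth (m + 1) P) (u : E) :
    PolyGrowth m fun z => P (z + u) - P z := by
  obtain ⟨C, hC0, hC⟩ := hP.growth_pos
  refine ⟨fun z v => ((hP.translate u).entire z v).sub (hP.entire z v),
    max (4 * C * 2 ^ (m + 1) * (1 + ‖u‖)) (2 * C * (2 * (1 + ‖u‖)) ^ (m + 1)), fun z => ?_⟩
  have hz := norm_nonneg z
  have hu := norm_nonneg u
  rcases le_or_gt (1 + ‖u‖) (1 + ‖z‖) with h | h
  · have h1 := norm_sub_le_of_entire (hP.entire z u) (ρ := (1 + ‖z‖) / (1 + ‖u‖))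
      (M := C * (2 * (1 + ‖z‖)) ^ (m + 1)) (by rwa [le_div_iff₀ (by positivity), one_mul])
      fun c hc => (hC _).trans ?_
    · simp only [one_smul, zero_smul, add_zero] at h1
      refine (h1.trans (le_of_eq ?_)).trans (mul_le_mul_of_nonneg_right (le_max_left _ _)
        (by positivity))
      field_simp
      rw [mul_pow]
      ring
    · gcongr
      rw [le_div_iff₀ (by positivity)] at hc
      have h2 := norm_add_le z (c • u)
      rw [norm_smul] at h2
      nlinarith [norm_nonneg c]
  · have h1 := norm_sub_le (P (z + u)) (P z)
    have h2 : ‖P (z + u)‖ ≤ C * (2 * (1 + ‖u‖)) ^ (m + 1) := (hC _).trans (by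
      gcongr
      linarith [norm_add_le z u])
    have h3 : ‖P z‖ ≤ C * (2 * (1 + ‖u‖)) ^ (m + 1) := (hC _).trans (by
      gcongr
      linarith)
    calc _ ≤ 2 * C * (2 * (1 + ‖u‖)) ^ (m + 1) := by linarith
      _ ≤ max (4 * C * 2 ^ (m + 1) * (1 + ‖u‖)) (2 * C * (2 * (1 + ‖u‖)) ^ (m + 1)) * 1 := by
        rw [mul_one]; exact le_max_right _ _
      _ ≤ _ := by
        gcongr
        exact one_le_pow₀ (by linarith)

theorem eq_const (hP : PolyGrowth 0 P) (z w : E) : P z = P w := by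
  obtain ⟨C, hC⟩ := hP.growth
  have := Differentiable.apply_eq_apply_of_bounded (hP.entire w (z - w))
    (isBounded_iff_forall_norm_le.2 ⟨C, by rintro _ ⟨c, rfl⟩; simpa using hC (w + c • (z - w))⟩) 1 0
  simpa using this

end PolyGrowth

/-! ### Truncation of null sequences -/

/-- The null sequence with the first `k` entries of `x` and zeros afterwards. -/
def truncate (k : ℕ) (x : ℕ → ℂ) : C₀(ℕ, ℂ) where
  toFun i := if i < k then x i else 0
  continuous_toFun := continuous_of_discreteTopology
  zero_at_infty' := by
    rw [cocompact_eq_cofinite, Nat.cofinite_eq_atTop]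
    refine tendsto_const_nhds.congr' ?_
    filter_upwards [eventually_ge_atTop k] with i hi
    simp [hi]

@[simp] theorem truncate_apply (k : ℕ) (x : ℕ → ℂ) (i : ℕ) :
    truncate k x i = if i < k then x i else 0 := rfl

theorem norm_apply_le (z : C₀(ℕ, ℂ)) (i : ℕ) : ‖z i‖ ≤ ‖z‖ := by
  simpa using z.toBCF.norm_coe_le_norm i

theorem norm_le_iff {z : C₀(ℕ, ℂ)} {C : ℝ} (hC : 0 ≤ C) : ‖z‖ ≤ C ↔ ∀ i, ‖z i‖ ≤ C := by
  simpa using BoundedContinuousFunction.norm_le (f := z.toBCF) hC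

theorem norm_truncate_le {k : ℕ} {x : ℕ → ℂ} {C : ℝ} (hC : 0 ≤ C) (h : ∀ i < k, ‖x i‖ ≤ C) :
    ‖truncate k x‖ ≤ C := by
  refine (norm_le_iff hC).2 fun i => ?_
  rw [truncate_apply]
  split_ifs with hi
  · exact h i hi
  · simpa using hC

theorem norm_truncate_le_norm (k : ℕ) (z : C₀(ℕ, ℂ)) : ‖truncate k z‖ ≤ ‖z‖ :=
  norm_truncate_le (norm_nonneg _) fun i _ => norm_apply_le z i

theorem exists_norm_sub_truncate_le (z : C₀(ℕ, ℂ)) {ε : ℝ} (hε : 0 < ε) :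
    ∃ N, ‖z - truncate N z‖ ≤ ε := by
  have h := z.zero_at_infty'
  rw [cocompact_eq_cofinite, Nat.cofinite_eq_atTop] at h
  obtain ⟨N, hN⟩ := Metric.tendsto_atTop.1 h ε hε
  refine ⟨N, (norm_le_iff hε.le).2 fun i => ?_⟩
  simp only [ZeroAtInftyContinuousMap.coe_sub, Pi.sub_apply, truncate_apply]
  split_ifs with hi
  · simpa using hε.le
  · simpa using (hN i (not_lt.1 hi)).le

/-- Truncations of the unit ball come from the compact unit ball of `Fin K → ℂ` through a
nonexpansive embedding. -/
theorem exists_finite_net_truncate (K : ℕ) {η : ℝ} (hη : 0 < η) :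
    ∃ t : Finset C₀(ℕ, ℂ), (∀ a ∈ t, ‖a‖ ≤ 1) ∧
      ∀ z : C₀(ℕ, ℂ), ‖z‖ ≤ 1 → ∃ a ∈ t, ‖truncate K z - a‖ ≤ η := by
  let ι : (Fin K → ℂ) → C₀(ℕ, ℂ) := fun x => truncate K fun i => if h : i < K then x ⟨i, h⟩ else 0
  have hι : ∀ x y, ‖ι x - ι y‖ ≤ ‖x - y‖ := by
    intro x y
    refine (norm_le_iff (norm_nonneg _)).2 fun i => ?_
    simp only [ι, ZeroAtInftyContinuousMap.coe_sub, Pi.sub_apply, truncate_apply]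
    split_ifs with hi
    · exact norm_le_pi_norm (x - y) ⟨i, hi⟩
    · simp
  have htr : ∀ z : C₀(ℕ, ℂ), truncate K z = ι fun i : Fin K => z i := by
    intro z
    ext i
    simp only [ι, truncate_apply]
    split_ifs <;> rfl
  have hι1 : ∀ x, ‖x‖ ≤ 1 → ‖ι x‖ ≤ 1 := by
    intro x hx
    refine norm_truncate_le zero_le_one fun i hi => ?_
    rw [dif_pos hi]
    exact (norm_le_pi_norm x ⟨i, hi⟩).trans hx
  clear_value ι
  obtain ⟨t, ht, hfin, hcov⟩ := (isCompact_closedBall (0 : Fin K → ℂ) 1).finite_cover_balls hη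
  classical
  refine ⟨hfin.toFinset.image ι, ?_, ?_⟩
  · intro a ha
    obtain ⟨x, hx, rfl⟩ := Finset.mem_image.1 ha
    exact hι1 x (by simpa using ht (hfin.mem_toFinset.1 hx))
  · intro z hz
    have hz' : (fun i : Fin K => z i) ∈ Metric.closedBall (0 : Fin K → ℂ) 1 := by
      rw [mem_closedBall_zero_iff, pi_norm_le_iff_of_nonneg zero_le_one]
      exact fun i => (norm_apply_le z i).trans hz
    obtain ⟨x, hx, hxz⟩ := Set.mem_iUnion₂.1 (hcov hz')
    refine ⟨ι x, Finset.mem_image_of_mem _ (hfin.mem_toFinset.2 hx), ?_⟩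
    rw [htr]
    refine le_trans (hι _ _) ?_
    rw [← dist_eq_norm]
    exact (Metric.mem_ball.1 hxz).le

/-! ### Polynomials on `c₀` depend on finitely many coordinates, up to a small error -/

/-- Up to a small error, the values of `P` on the closed unit ball of `c₀` depend only on finitely
many coordinates. -/
def AlmostFinite (P : C₀(ℕ, ℂ) → ℂ) : Prop :=
  ∀ ε > 0, ∃ k, ∀ z w : C₀(ℕ, ℂ), ‖z‖ ≤ 1 → ‖w‖ ≤ 1 → (∀ i < k, z i = w i) → ‖P z - P w‖ ≤ ε

/-- If `P` is not almost finite, it is far from constant on vectors supported far out. -/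
theorem exists_hump {m : ℕ} {P : C₀(ℕ, ℂ) → ℂ} (hP : PolyGrowth (m + 1) P)
    (IH : ∀ u, AlmostFinite fun z => P (z + u) - P z) {ε : ℝ} (hε : 0 < ε)
    (hfail : ∀ k, ∃ z w : C₀(ℕ, ℂ), ‖z‖ ≤ 1 ∧ ‖w‖ ≤ 1 ∧ (∀ i < k, z i = w i) ∧
      ε < ‖P z - P w‖) (K : ℕ) :
    ∃ w : C₀(ℕ, ℂ), ‖w‖ ≤ 1 ∧ (∀ i < K, w i = 0) ∧ ε / 4 < ‖P w - P 0‖ := by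
  obtain ⟨L, hL, hlip⟩ := hP.lipschitz 2
  -- The common head `b` of `z` and `w` is known only after the cutoff is chosen, and the cutoff
  -- must serve the translate by `-b`. A finite net of possible heads lets one cutoff `t.sup k`
  -- serve a translate by `-a` with `a` close to `b`.
  obtain ⟨t, ht1, ht⟩ := exists_finite_net_truncate K (η := ε / (8 * L)) (by positivity)
  choose k hk using fun a : C₀(ℕ, ℂ) => IH (-a) (ε / 4) (by positivity)
  obtain ⟨z, w, hz, hw, hzw, hP1⟩ := hfail (max K (t.sup k))
  obtain ⟨a, hat, ha⟩ := ht z hz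
  have hb : truncate K z = truncate K w := by
    ext i
    simp only [truncate_apply]
    split_ifs with hi
    · exact hzw i (lt_max_of_lt_left hi)
    · rfl
  set b := truncate K z with hbdef
  have htail : ∀ x : C₀(ℕ, ℂ), ‖x‖ ≤ 1 → ‖x - truncate K x‖ ≤ 1 := by
    intro x hx
    refine (norm_le_iff zero_le_one).2 fun i => ?_
    simp only [ZeroAtInftyContinuousMap.coe_sub, Pi.sub_apply, truncate_apply]
    split_ifs
    · simp
    · simpa using (norm_apply_le x i).trans hx
  have hnear : ∀ x : C₀(ℕ, ℂ), ‖x‖ ≤ 1 → ‖x - b‖ ≤ 1 → ‖P (x - b) - P (x + -a)‖ ≤ ε / 8 := by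
    intro x hx hxb
    refine (hlip _ _ (by linarith) ?_).trans ?_
    · exact (norm_add_le _ _).trans (by rw [norm_neg]; linarith [ht1 a hat])
    · rw [show x - b - (x + -a) = -(b - a) by abel, norm_neg]
      calc L * ‖b - a‖ ≤ L * (ε / (8 * L)) := by gcongr
        _ = ε / 8 := by field_simp
  have hzb : ‖z - b‖ ≤ 1 := htail z hz
  have hwb : ‖w - b‖ ≤ 1 := by rw [hb]; exact htail w hw
  have h1 := hnear z hz hzb
  have h2 := hnear w hw hwb
  have h3 := hk a z w hz hw fun i hi => hzw i (lt_max_of_lt_right (hi.trans_le (Finset.le_sup hat)))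
  -- The difference of `P` at the tails `z - b` and `w - b` equals `P z - P w` up to `ε / 8 + ε / 8
  -- + ε / 4`, so `P` differs from `P 0` by more than `ε / 4` at one of the tails.
  have hsum : P z - P w = (P (z - b) - P 0) - (P (w - b) - P 0) - (P (z - b) - P (z + -a))
      + (P (w - b) - P (w + -a)) - ((P (z + -a) - P z) - (P (w + -a) - P w)) := by ring
  have h4 : ‖P z - P w‖ ≤ ‖P (z - b) - P 0‖ + ‖P (w - b) - P 0‖ + ε / 8 + ε / 8 + ε / 4 := by
    rw [hsum]
    refine (norm_sub_le _ _).trans (add_le_add ((norm_add_le _ _).trans (add_le_add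
      ((norm_sub_le _ _).trans (add_le_add (norm_sub_le _ _) h1)) h2)) h3)
  by_contra! hcon
  have h5 := hcon (z - b) hzb fun i hi => by simp [hbdef, hi]
  have h6 := hcon (w - b) hwb fun i hi => by simp [hb, hi]
  linarith

/-- A number of modulus above `ε` has real part above `ε / 2` after multiplication by one of `1, -1,
I, -I`. As `Q K` shrinks with `K`, one of these four works for every `K`: if each failed at some
index, the sum of the four indices would give a contradiction. -/
theorem exists_direction {ι : Type*} {Q : ℕ → ι → Prop} (hQ : ∀ K L w, K ≤ L → Q L w → Q K w)
    {f : ι → ℂ} {ε : ℝ} (h : ∀ K, ∃ w, Q K w ∧ ε < ‖f w‖) :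
    ∃ d : ℂ, ‖d‖ = 1 ∧ ∀ K, ∃ w, Q K w ∧ ε / 2 < (d * f w).re := by
  by_contra! hcon
  obtain ⟨K1, h1⟩ := hcon 1 (by simp)
  obtain ⟨K2, h2⟩ := hcon (-1) (by simp)
  obtain ⟨K3, h3⟩ := hcon Complex.I (by simp)
  obtain ⟨K4, h4⟩ := hcon (-Complex.I) (by simp)
  obtain ⟨w, hw, hf⟩ := h (K1 + K2 + K3 + K4)
  have g1 := h1 w (hQ _ _ w (by omega) hw)
  have g2 := h2 w (hQ _ _ w (by omega) hw)
  have g3 := h3 w (hQ _ _ w (by omega) hw)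
  have g4 := h4 w (hQ _ _ w (by omega) hw)
  simp at g1 g2 g3 g4
  have hre : |(f w).re| ≤ ε / 2 := abs_le.2 ⟨by linarith, g1⟩
  have him : |(f w).im| ≤ ε / 2 := abs_le.2 ⟨by linarith, g4⟩
  linarith [Complex.norm_le_abs_re_add_abs_im (f w)]

/-- Gliding hump, by induction on the degree. On failure there are humps arbitrarily far out at
which `P - P 0` has real part at least `ε / 8` in a fixed direction. The difference `P (· + u) - P`
is almost finite by induction, so adding a far hump to `u` adds nearly the full increment.
Disjointly supported vectors of norm at most `1` have a sum of norm at most `1`, so `P` would be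
unbounded on the unit ball. -/
theorem PolyGrowth.almostFinite {m : ℕ} {P : C₀(ℕ, ℂ) → ℂ} (hP : PolyGrowth m P) :
    AlmostFinite P := by
  induction m generalizing P with
  | zero => exact fun ε hε => ⟨0, fun z w _ _ _ => by simp [hP.eq_const z w, hε.le]⟩
  | succ m ih =>
    have IH : ∀ u, AlmostFinite fun z => P (z + u) - P z := fun u => ih (hP.difference u)
    by_contra hcon
    unfold AlmostFinite at hcon
    push Not at hcon
    obtain ⟨ε, hε, hfail⟩ := hcon
    obtain ⟨d, hd, hhump⟩ := exists_direction
      (Q := fun K (w : C₀(ℕ, ℂ)) => ‖w‖ ≤ 1 ∧ ∀ i < K, w i = 0) (f := fun w => P w - P 0)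
      (ε := ε / 4) (fun K L w hKL hw => ⟨hw.1, fun i hi => hw.2 i (hi.trans_le hKL)⟩)
      fun K => by
        obtain ⟨w, h1, h2, h3⟩ := exists_hump hP IH hε hfail K
        exact ⟨w, ⟨h1, h2⟩, h3⟩
    obtain ⟨L, hL, hlip⟩ := hP.lipschitz 1
    have hdre : ∀ x : ℂ, -‖x‖ ≤ (d * x).re := fun x => by
      have := Complex.abs_re_le_norm (d * x)
      rw [norm_mul, hd, one_mul] at this
      exact (abs_le.1 this).1
    have hstep : ∀ n : ℕ, ∃ u : C₀(ℕ, ℂ), ‖u‖ ≤ 1 ∧ (∃ K, ∀ i ≥ K, u i = 0) ∧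
        n * (ε / 32) ≤ (d * (P u - P 0)).re := by
      intro n
      induction n with
      | zero => exact ⟨0, by simp, ⟨0, by simp⟩, by simp⟩
      | succ n ihn =>
        obtain ⟨u, hu, ⟨K, hK⟩, hun⟩ := ihn
        obtain ⟨k, hk⟩ := IH u (ε / 32) (by positivity)
        obtain ⟨w, ⟨hw, hwK⟩, hwd⟩ := hhump (max K k)
        -- The hump is cut to finite support so that the next one can be disjoint from it. The gain
        -- `ε / 8`, less `ε / 32` here and `ε / 32` from the induction hypothesis, exceeds `ε / 32`.
        obtain ⟨N, hN⟩ := exists_norm_sub_truncate_le w (ε := ε / (32 * L)) (by positivity)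
        set v := truncate N w with hv
        have hv1 : ‖v‖ ≤ 1 := (norm_truncate_le_norm N w).trans hw
        have hv0 : ∀ i < max K k, v i = 0 := fun i hi => by simp [hv, hwK i hi]
        have h1 : ‖P w - P v‖ ≤ ε / 32 := (hlip w v hw hv1).trans (by
          calc L * ‖w - v‖ ≤ L * (ε / (32 * L)) := by gcongr
            _ = ε / 32 := by field_simp)
        have h2 := hk v 0 hv1 (by simp) fun i hi => by
          simpa using hv0 i (lt_max_of_lt_right hi)
        simp only [zero_add] at h2
        refine ⟨v + u, ?_, ⟨max K N, fun i hi => ?_⟩, ?_⟩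
        · refine (norm_le_iff zero_le_one).2 fun i => ?_
          rcases lt_or_ge i K with hi | hi
          · simpa [hv0 i (lt_max_of_lt_left hi)] using (norm_apply_le u i).trans hu
          · simpa [hK i hi] using (norm_apply_le v i).trans hv1
        · have : ¬ i < N := not_lt.2 ((le_max_right _ _).trans hi)
          simp [hK i ((le_max_left _ _).trans hi), hv, this]
        · have hsplit : d * (P (v + u) - P 0) = d * ((P (v + u) - P v) - (P u - P 0))
              + d * (P w - P 0) + d * (P u - P 0) + d * -(P w - P v) := by ring
          rw [hsplit]
          simp only [Complex.add_re]
          have h3 := hdre ((P (v + u) - P v) - (P u - P 0))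
          have h4 := hdre (-(P w - P v))
          rw [norm_neg] at h4
          push_cast
          linarith
    obtain ⟨M, hM0, hM⟩ := hP.bounded 1
    obtain ⟨n, hn⟩ := exists_nat_gt (2 * M / (ε / 32))
    rw [div_lt_iff₀ (by positivity)] at hn
    obtain ⟨u, hu, -, hun⟩ := hstep n
    have h1 := Complex.re_le_norm (d * (P u - P 0))
    rw [norm_mul, hd, one_mul] at h1
    have h2 := norm_sub_le (P u) (P 0)
    have := hM u hu
    have := hM 0 (by simp)
    linarith

/-! ### Functions of polynomial growth in finitely many coordinates are polynomials. -/

/-- The quotient `(φ c - φ 0) / c` extends to an entire function of growth one degree lower;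
Liouville's theorem is the base case. -/
theorem exists_polynomial_of_growth {φ : ℂ → ℂ} (hφ : Differentiable ℂ φ) {m : ℕ} {C : ℝ}
    (hC : ∀ c, ‖φ c‖ ≤ C * (1 + ‖c‖) ^ m) :
    ∃ p : Polynomial ℂ, p.degree < (m + 1 : ℕ) ∧ ∀ c, φ c = p.eval c := by
  induction m generalizing φ C with
  | zero =>
    refine ⟨Polynomial.C (φ 0), ?_, fun c => ?_⟩
    · simpa using (Polynomial.degree_C_le).trans_lt (by norm_num)
    · rw [Polynomial.eval_C]
      exact hφ.apply_eq_apply_of_bounded (isBounded_iff_forall_norm_le.2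
        ⟨C, by rintro _ ⟨c, rfl⟩; simpa using hC c⟩) _ _
  | succ m ih =>
    have hC0 : 0 ≤ C := by simpa using (norm_nonneg _).trans (hC 0)
    have hd : Differentiable ℂ (dslope φ 0) := by
      rw [← differentiableOn_univ, Complex.differentiableOn_dslope univ_mem]
      exact hφ.differentiableOn
    obtain ⟨B, hB⟩ := (isCompact_closedBall (0 : ℂ) 1).exists_bound_of_continuousOn
      hd.continuous.continuousOn
    obtain ⟨p, hp, hpe⟩ := ih hd (C := max B (4 * C)) fun c => by
      rcases le_or_gt ‖c‖ 1 with h1 | h1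
      · calc _ ≤ max B (4 * C) * 1 := by
              rw [mul_one]; exact (hB c (by simpa using h1)).trans (le_max_left _ _)
          _ ≤ _ := by
            gcongr
            exact one_le_pow₀ (by linarith [norm_nonneg c])
      · have hc : c ≠ 0 := norm_pos_iff.1 (by linarith)
        rw [dslope_of_ne _ hc, slope_def_field, sub_zero, norm_div, div_le_iff₀ (by linarith)]
        have h2 := norm_sub_le (φ c) (φ 0)
        have h3 := hC c
        have h4 : ‖φ 0‖ ≤ C * (1 + ‖c‖) ^ (m + 1) := (hC 0).trans (by
          gcongr
          simp)
        calc _ ≤ 2 * C * (1 + ‖c‖) ^ (m + 1) := by linarith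
          _ = 2 * C * (1 + ‖c‖) ^ m * (1 + ‖c‖) := by ring
          _ ≤ 2 * C * (1 + ‖c‖) ^ m * (2 * ‖c‖) := by gcongr; linarith
          _ = 4 * C * (1 + ‖c‖) ^ m * ‖c‖ := by ring
          _ ≤ _ := by
            gcongr
            exact le_max_right _ _
    refine ⟨Polynomial.X * p + Polynomial.C (φ 0), ?_, fun c => ?_⟩
    · refine (Polynomial.degree_add_le _ _).trans_lt (max_lt ?_ ?_)
      · rw [mul_comm, Polynomial.degree_mul_X, Nat.cast_add (m + 1) 1]
        exact WithBot.add_lt_add_right (by simp) hp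
      · exact Polynomial.degree_C_le.trans_lt (by norm_cast; omega)
    · have h := sub_smul_dslope φ 0 c
      rw [sub_zero, smul_eq_mul, hpe] at h
      simp [h]

/-- In its last coordinate the function is a polynomial of degree at most `m`, recovered by Lagrange
interpolation from its values at `0, …, m`. These values belong to translates of `P`, which are
polynomials in the earlier coordinates by induction. -/
theorem PolyGrowth.exists_mvPolynomial {m : ℕ} {P : C₀(ℕ, ℂ) → ℂ} (hP : PolyGrowth m P) (k : ℕ) :
    ∃ p : MvPolynomial ℕ ℂ, ∀ z : C₀(ℕ, ℂ), P (truncate k z) = MvPolynomial.eval z p := by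
  induction k generalizing P with
  | zero =>
    refine ⟨MvPolynomial.C (P 0), fun z => ?_⟩
    rw [MvPolynomial.eval_C]
    congr 1
  | succ k ih =>
    let e : C₀(ℕ, ℂ) := truncate (k + 1) fun i => if i = k then 1 else 0
    have he : ‖e‖ ≤ 1 := norm_truncate_le zero_le_one fun i _ => by split_ifs <;> simp
    choose q hq using fun i : ℕ => ih (hP.translate ((i : ℂ) • e))
    let ℓ := fun i => Lagrange.basis (Finset.range (m + 1)) (fun i : ℕ => (i : ℂ)) i
    refine ⟨∑ i ∈ Finset.range (m + 1), q i * Polynomial.aeval (MvPolynomial.X k) (ℓ i),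
      fun z => ?_⟩
    obtain ⟨C, hC0, hC⟩ := hP.growth_pos
    obtain ⟨p, hp, hpe⟩ := exists_polynomial_of_growth (hP.entire (truncate k z) e) (m := m)
      (C := C * (1 + ‖truncate k z‖) ^ m) fun c => (hC _).trans (by
        rw [mul_assoc, ← mul_pow]
        gcongr
        have h1 := norm_add_le (truncate k z) (c • e)
        rw [norm_smul] at h1
        nlinarith [norm_nonneg (truncate k z), norm_nonneg c])
    have hinj : Set.InjOn (fun i : ℕ => (i : ℂ)) (Finset.range (m + 1)) :=
      Nat.cast_injective.injOn
    have hinterp := Lagrange.eq_interpolate hinj (f := p) (by simpa using hp)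
    rw [Lagrange.interpolate_apply] at hinterp
    have hz : truncate (k + 1) z = truncate k z + z k • e := by
      ext i
      rcases lt_trichotomy i k with h | h | h
      · simp [e, h, h.trans (Nat.lt_succ_self k), h.ne]
      · simp [e, h]
      · simp [e, not_lt.2 h.le, not_lt.2 (Nat.succ_le_of_lt h)]
    rw [hz, hpe (z k), hinterp, Polynomial.eval_finsetSum, map_sum]
    refine Finset.sum_congr rfl fun i _ => ?_
    rw [Polynomial.eval_mul, Polynomial.eval_C, ← hpe, map_mul, ← hq i]
    congr 1
    rw [← Polynomial.coe_aeval_eq_eval, ← MvPolynomial.coe_aeval_eq_eval]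
    change _ = MvPolynomial.aeval (z : ℕ → ℂ) (Polynomial.aeval (MvPolynomial.X k) (ℓ i))
    rw [← Polynomial.aeval_algHom_apply, MvPolynomial.aeval_X]

section Algebra

variable {E : Type*} [NormedAddCommGroup E] [NormedSpace ℂ E]

theorem PolyGrowth.mono {m n : ℕ} (h : m ≤ n) {P : E → ℂ} (hP : PolyGrowth m P) :
    PolyGrowth n P := by
  obtain ⟨C, hC0, hC⟩ := hP.growth_pos
  refine ⟨hP.entire, C, fun z => (hC z).trans ?_⟩
  gcongr
  linarith [norm_nonneg z]

theorem PolyGrowth.sum {m : ℕ} {ι : Type*} {s : Finset ι} {P : ι → E → ℂ} (c : ι → ℂ)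
    (hP : ∀ i ∈ s, PolyGrowth m (P i)) : PolyGrowth m fun z => ∑ i ∈ s, c i * P i z := by
  have h : ∀ i, ∃ C : ℝ, i ∈ s → ∀ z, ‖P i z‖ ≤ C * (1 + ‖z‖) ^ m := fun i => by
    by_cases hi : i ∈ s
    · exact (hP i hi).growth.imp fun C hC _ => hC
    · exact ⟨0, fun h => absurd h hi⟩
  choose C hC using h
  refine ⟨fun z u => Differentiable.fun_sum fun i hi => ((hP i hi).entire z u).const_mul _,
    ∑ i ∈ s, ‖c i‖ * C i, fun z => ?_⟩
  rw [Finset.sum_mul]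
  refine norm_sum_le_of_le _ fun i hi => ?_
  rw [norm_mul, mul_assoc]
  exact mul_le_mul_of_nonneg_left (hC i hi z) (norm_nonneg _)

end Algebra

/-! ### Homogeneous Taylor terms -/

section Taylor

variable {E : Type*} [NormedAddCommGroup E] [NormedSpace ℂ E]

/-- The homogeneous Taylor term of degree `l` at the origin. -/
noncomputable def taylorTerm (F : E → ℂ) (l : ℕ) (w : E) : ℂ :=
  (l.factorial : ℂ)⁻¹ * iteratedDeriv l (fun c : ℂ => F (c • w)) 0

variable {F : E → ℂ} {M : ℝ}

theorem differentiableOn_slice (hF : DifferentiableOn ℂ F (Metric.ball 0 1)) {w : E} {r : ℝ}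
    (hr : r * ‖w‖ ≤ 1) : DifferentiableOn ℂ (fun c : ℂ => F (c • w)) (Metric.ball 0 r) := by
  refine hF.comp (differentiable_id.smul_const w).differentiableOn fun c hc => ?_
  rw [mem_ball_zero_iff] at hc ⊢
  change ‖c • w‖ < 1
  rw [norm_smul]
  rcases (norm_nonneg w).eq_or_lt with h | h
  · rw [← h]; simp
  · nlinarith

/-- Cauchy's estimate on the circle of radius `1 / b` in the slice through `w`, for every `b > ‖w‖`,
followed by `b → ‖w‖`. Using `b` also covers `w = 0`. -/
theorem norm_taylorTerm_le (hF : DifferentiableOn ℂ F (Metric.ball 0 1))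
    (hM : ∀ z, ‖z‖ < 1 → ‖F z‖ ≤ M) (l : ℕ) (w : E) : ‖taylorTerm F l w‖ ≤ M * ‖w‖ ^ l := by
  have h : ∀ b : ℝ, ‖w‖ < b → ‖taylorTerm F l w‖ ≤ M * b ^ l := by
    intro b hb
    have hb0 : 0 < b := (norm_nonneg w).trans_lt hb
    obtain ⟨b', hwb', hb'⟩ := exists_between hb
    have hb'0 : 0 < b' := (norm_nonneg w).trans_lt hwb'
    have hd := (differentiableOn_slice hF (w := w) (r := b'⁻¹) (by
      rw [inv_mul_le_iff₀ hb'0]; linarith))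
    have := Complex.norm_iteratedDeriv_le_of_forall_mem_sphere_norm_le l (inv_pos.2 hb0)
      (c := 0) (C := M) (f := fun c : ℂ => F (c • w)) (DifferentiableOn.diffContOnCl (by
        rw [closure_ball _ (inv_pos.2 hb0).ne']
        exact hd.mono (Metric.closedBall_subset_ball (inv_strictAnti₀ hb'0 hb')))) (by
        intro c hc
        rw [mem_sphere_zero_iff_norm] at hc
        refine hM _ ?_
        rw [norm_smul, hc, inv_mul_lt_iff₀ hb0]
        linarith)
    rw [taylorTerm, norm_mul, norm_inv, Complex.norm_natCast,
      inv_mul_le_iff₀ (by positivity)]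
    refine this.trans (le_of_eq ?_)
    rw [inv_pow, div_inv_eq_mul]
    ring
  have hlim : Tendsto (fun b : ℝ => M * b ^ l) (𝓝[>] ‖w‖) (𝓝 (M * ‖w‖ ^ l)) :=
    ((continuous_const.mul (continuous_pow l)).tendsto _).mono_left nhdsWithin_le_nhds
  exact ge_of_tendsto hlim (by filter_upwards [self_mem_nhdsWithin] with b hb using h b hb)

theorem hasSum_taylorTerm (hF : DifferentiableOn ℂ F (Metric.ball 0 1)) {w : E} {c : ℂ}
    (hc : ‖c‖ * ‖w‖ < 1) : HasSum (fun l => c ^ l * taylorTerm F l w) (F (c • w)) := by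
  obtain ⟨r, hcr, hr⟩ : ∃ r, ‖c‖ < r ∧ r * ‖w‖ ≤ 1 := by
    rcases (norm_nonneg w).eq_or_lt with h | h
    · exact ⟨‖c‖ + 1, by linarith, by rw [← h]; simp⟩
    · exact ⟨1 / ‖w‖, by rwa [lt_div_iff₀ h], by rw [one_div_mul_cancel h.ne']⟩
  have := Complex.hasSum_taylorSeries_on_ball (differentiableOn_slice hF hr)
    (z := c) (by simpa using hcr)
  refine this.congr_fun fun l => ?_
  simp [taylorTerm]
  ring

theorem norm_sub_taylor_le (hF : DifferentiableOn ℂ F (Metric.ball 0 1))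
    (hM : ∀ z, ‖z‖ < 1 → ‖F z‖ ≤ M) (m : ℕ) {w : E} {c : ℂ} {t : ℝ} (hc : ‖c‖ * ‖w‖ ≤ t)
    (ht : t < 1) :
    ‖F (c • w) - ∑ l ∈ Finset.range m, c ^ l * taylorTerm F l w‖ ≤ M * t ^ m / (1 - t) := by
  have ht0 : 0 ≤ t := le_trans (by positivity) hc
  have hM0 : 0 ≤ M := (norm_nonneg _).trans (hM 0 (by simp))
  have h1 := (hasSum_nat_add_iff' m).2 (hasSum_taylorTerm hF (hc.trans_lt ht))
  have h2 : HasSum (fun l => M * t ^ m * t ^ l) (M * t ^ m * (1 - t)⁻¹) :=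
    (hasSum_geometric_of_lt_one ht0 ht).mul_left _
  rw [div_eq_mul_inv]
  refine h1.norm_le_of_bounded h2 fun l => ?_
  rw [norm_mul, norm_pow]
  calc ‖c‖ ^ (l + m) * ‖taylorTerm F (l + m) w‖ ≤ ‖c‖ ^ (l + m) * (M * ‖w‖ ^ (l + m)) := by
        gcongr
        exact norm_taylorTerm_le hF hM _ _
    _ = M * (‖c‖ * ‖w‖) ^ (l + m) := by rw [mul_pow]; ring
    _ ≤ M * t ^ (l + m) := by gcongr
    _ = _ := by rw [pow_add]; ring

/-- Along the line `w = z + c • u`, the `m`-th term is the locally uniform limit, as `ζ → 0`, of `F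
(ζ • w)` minus the lower terms, divided by `ζ ^ m`. These quotients are holomorphic in `c` by strong
induction. -/
theorem differentiable_taylorTerm (hF : DifferentiableOn ℂ F (Metric.ball 0 1))
    (hM : ∀ z, ‖z‖ < 1 → ‖F z‖ ≤ M) (m : ℕ) (z u : E) :
    Differentiable ℂ fun c : ℂ => taylorTerm F m (z + c • u) := by
  have hM0 : 0 ≤ M := (norm_nonneg _).trans (hM 0 (by simp))
  induction m using Nat.strong_induction_on with
  | _ m ih =>
  intro c₀
  set R := ‖z‖ + (‖c₀‖ + 1) * ‖u‖ + 1 with hR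
  have hR0 : 0 < R := by positivity
  have hball : ∀ c ∈ Metric.ball c₀ 1, ‖z + c • u‖ ≤ R := by
    intro c hc
    rw [mem_ball_iff_norm] at hc
    have h1 := norm_add_le z (c • u)
    have h2 := norm_le_norm_add_norm_sub' c c₀
    rw [norm_smul] at h1
    nlinarith [norm_nonneg u]
  -- This size keeps `ζ n • (z + c • u)` in the ball of radius `1 / 2` for all `c` near `c₀`, and
  -- makes the error at most `2 * M * R ^ m / (n + 2)`.
  let ζ : ℕ → ℂ := fun n => (((n + 2 : ℝ) * R)⁻¹ : ℝ)
  have hζn : ∀ n, ‖ζ n‖ = ((n + 2 : ℝ) * R)⁻¹ := fun n => by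
    simp only [ζ, Complex.norm_real]
    exact Real.norm_of_nonneg (by positivity)
  have hζ0 : ∀ n, ζ n ≠ 0 := fun n => norm_pos_iff.1 (by rw [hζn]; positivity)
  have hζw : ∀ n, ∀ c ∈ Metric.ball c₀ 1, ‖ζ n‖ * ‖z + c • u‖ ≤ 1 / (n + 2 : ℝ) := by
    intro n c hc
    calc ‖ζ n‖ * ‖z + c • u‖ ≤ ‖ζ n‖ * R := by gcongr; exact hball c hc
      _ = _ := by rw [hζn]; field_simp
  have hn1 : ∀ n : ℕ, 1 / (n + 2 : ℝ) ≤ 1 / 2 := fun n =>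
    one_div_le_one_div_of_le (by norm_num) (by linarith [n.cast_nonneg (α := ℝ)])
  let H : ℕ → ℂ → ℂ := fun n c => (ζ n ^ m)⁻¹ * (F (ζ n • (z + c • u)) -
    ∑ l ∈ Finset.range m, ζ n ^ l * taylorTerm F l (z + c • u))
  have hH : ∀ n, DifferentiableOn ℂ (H n) (Metric.ball c₀ 1) := by
    intro n
    refine DifferentiableOn.const_mul (DifferentiableOn.sub ?_ ?_) _
    · refine hF.comp (Differentiable.differentiableOn (by fun_prop)) fun c hc => ?_
      rw [mem_ball_zero_iff, norm_smul]
      linarith [hζw n c hc, hn1 n]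
    · exact DifferentiableOn.fun_sum fun l hl =>
        ((ih l (Finset.mem_range.1 hl)).differentiableOn).const_mul _
  have hlim : TendstoUniformlyOn H (fun c => taylorTerm F m (z + c • u)) atTop
      (Metric.ball c₀ 1) := by
    rw [Metric.tendstoUniformlyOn_iff]
    intro ε hε
    have hto : Tendsto (fun n : ℕ => 2 * M * R ^ m * (1 / (n + 2 : ℝ))) atTop (𝓝 0) := by
      have : Tendsto (fun n : ℕ => 1 / (n + 2 : ℝ)) atTop (𝓝 0) :=
        tendsto_const_nhds.div_atTop (tendsto_atTop_add_const_right _ _ tendsto_natCast_atTop_atTop)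
      simpa using this.const_mul (2 * M * R ^ m)
    filter_upwards [hto.eventually_lt_const hε] with n hn c hc
    refine lt_of_le_of_lt ?_ hn
    have h1 := norm_sub_taylor_le hF hM (m + 1) (hζw n c hc) (by linarith [hn1 n])
    rw [Finset.sum_range_succ] at h1
    rw [dist_comm, dist_eq_norm]
    have h2 : H n c - taylorTerm F m (z + c • u) = (ζ n ^ m)⁻¹ * (F (ζ n • (z + c • u)) -
        (∑ l ∈ Finset.range m, ζ n ^ l * taylorTerm F l (z + c • u) +
          ζ n ^ m * taylorTerm F m (z + c • u))) := by
      have := pow_ne_zero m (hζ0 n)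
      simp only [H]
      field_simp
      ring
    rw [h2, norm_mul, norm_inv, norm_pow, hζn, inv_pow, inv_inv]
    have h3 : (1 - 1 / (n + 2 : ℝ))⁻¹ ≤ 2 := by
      rw [inv_le_comm₀ (by linarith [hn1 n]) (by norm_num)]
      linarith [hn1 n]
    calc ((n + 2 : ℝ) * R) ^ m * _ ≤ ((n + 2 : ℝ) * R) ^ m *
          (M * (1 / (n + 2 : ℝ)) ^ (m + 1) / (1 - 1 / (n + 2 : ℝ))) := by gcongr
      _ = M * R ^ m * (1 / (n + 2 : ℝ)) * (1 - 1 / (n + 2 : ℝ))⁻¹ := by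
        rw [div_eq_mul_inv _ (1 - _), mul_pow, pow_succ, one_div, inv_pow]
        field_simp
      _ ≤ M * R ^ m * (1 / (n + 2 : ℝ)) * 2 := by gcongr
      _ = _ := by ring
  have := hlim.tendstoLocallyUniformlyOn.differentiableOn (Eventually.of_forall hH)
    Metric.isOpen_ball
  exact (this c₀ (by simp)).differentiableAt (Metric.isOpen_ball.mem_nhds (by simp))

theorem polyGrowth_taylorTerm (hF : DifferentiableOn ℂ F (Metric.ball 0 1))
    (hM : ∀ z, ‖z‖ < 1 → ‖F z‖ ≤ M) (m : ℕ) : PolyGrowth m (taylorTerm F m) := by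
  have hM0 : 0 ≤ M := (norm_nonneg _).trans (hM 0 (by simp))
  refine ⟨differentiable_taylorTerm hF hM m, M, fun z => (norm_taylorTerm_le hF hM m z).trans ?_⟩
  gcongr
  linarith

end Taylor

/-! ### Polynomials are dense in the ball algebra -/

theorem exists_mvPolynomial_near {f : BallC0 → ℂ} (hf : f ∈ ballSubmodule) {ε : ℝ} (hε : 0 < ε) :
    ∃ p : MvPolynomial ℕ ℂ, ∀ z : BallC0, ‖f z - MvPolynomial.eval (z : C₀(ℕ, ℂ)) p‖ ≤ ε := by
  obtain ⟨M, hM⟩ := bounded_of_mem_ballSubmodule f hf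
  obtain ⟨hu, F, hF, hfF⟩ := hf
  have hMF : ∀ z : C₀(ℕ, ℂ), ‖z‖ < 1 → ‖F z‖ ≤ M := fun z hz => by
    have := hM ⟨⟨z, by simpa using hz⟩, rfl⟩
    simpa only [hfF] using this
  obtain ⟨δ, hδ, hfδ⟩ := Metric.uniformContinuous_iff.1 hu (ε / 3) (by positivity)
  obtain ⟨r, hr0, hr1, hrδ⟩ : ∃ r : ℝ, 0 < r ∧ r < 1 ∧ 1 - r < δ :=
    ⟨max (1 / 2) (1 - δ / 2), lt_max_of_lt_left (by norm_num),
      max_lt (by norm_num) (by linarith), by linarith [le_max_right (1 / 2) (1 - δ / 2)]⟩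
  have hscale : ∀ z : BallC0, ‖f z - F ((r : ℂ) • (z : C₀(ℕ, ℂ)))‖ ≤ ε / 3 := by
    intro z
    have hz : ‖(z : C₀(ℕ, ℂ))‖ < 1 := mem_ball_zero_iff.1 z.2
    have hrn : ‖(r : ℂ)‖ = r := by rw [Complex.norm_real, Real.norm_of_nonneg hr0.le]
    have hrz : (r : ℂ) • (z : C₀(ℕ, ℂ)) ∈ Metric.ball (0 : C₀(ℕ, ℂ)) 1 := by
      rw [mem_ball_zero_iff, norm_smul, hrn]
      nlinarith [norm_nonneg (z : C₀(ℕ, ℂ))]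
    have h := hfδ (a := z) (b := ⟨_, hrz⟩) (by
      rw [Subtype.dist_eq, dist_eq_norm]
      have h1 : (z : C₀(ℕ, ℂ)) - (r : ℂ) • (z : C₀(ℕ, ℂ)) = ((1 - r : ℝ) : ℂ) • (z : C₀(ℕ, ℂ)) := by
        ext i; simp; ring
      change ‖(z : C₀(ℕ, ℂ)) - (r : ℂ) • (z : C₀(ℕ, ℂ))‖ < δ
      rw [h1, norm_smul, Complex.norm_real, Real.norm_of_nonneg (by linarith)]
      nlinarith [norm_nonneg (z : C₀(ℕ, ℂ))])
    rw [dist_eq_norm, hfF ⟨_, hrz⟩] at h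
    exact h.le
  obtain ⟨m, hm⟩ : ∃ m : ℕ, M * r ^ m / (1 - r) ≤ ε / 3 := by
    have h : Tendsto (fun m : ℕ => M * r ^ m / (1 - r)) atTop (𝓝 (M * 0 / (1 - r))) :=
      ((tendsto_pow_atTop_nhds_zero_of_lt_one hr0.le hr1).const_mul M).div_const _
    rw [mul_zero, zero_div] at h
    exact (h.eventually_le_const (by positivity : (0 : ℝ) < ε / 3)).exists
  let Q : C₀(ℕ, ℂ) → ℂ := fun z => ∑ l ∈ Finset.range m, (r : ℂ) ^ l * taylorTerm F l z
  have hQ : PolyGrowth m Q := PolyGrowth.sum _ fun l hl =>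
    (polyGrowth_taylorTerm hF hMF l).mono (Finset.mem_range.1 hl).le
  obtain ⟨k, hk⟩ := hQ.almostFinite (ε / 3) (by positivity)
  obtain ⟨p, hp⟩ := hQ.exists_mvPolynomial k
  refine ⟨p, fun z => ?_⟩
  have hz : ‖(z : C₀(ℕ, ℂ))‖ < 1 := mem_ball_zero_iff.1 z.2
  have h1 := hscale z
  have h2 : ‖F ((r : ℂ) • (z : C₀(ℕ, ℂ))) - Q z‖ ≤ ε / 3 :=
    (norm_sub_taylor_le hF hMF m (by
      rw [Complex.norm_real, Real.norm_of_nonneg hr0.le]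
      exact mul_le_of_le_one_right hr0.le hz.le) hr1).trans hm
  have h3 := hk z (truncate k z) hz.le ((norm_truncate_le_norm k _).trans hz.le)
    fun i hi => by simp [hi]
  rw [hp] at h3
  calc _ = ‖(f z - F ((r : ℂ) • (z : C₀(ℕ, ℂ)))) + (F ((r : ℂ) • (z : C₀(ℕ, ℂ))) - Q z)
        + (Q z - MvPolynomial.eval (z : C₀(ℕ, ℂ)) p)‖ := by congr 1; ring
    _ ≤ _ := norm_add₃_le
    _ ≤ ε := by linarith

/-! ### Uniform limits of polynomials belong to the ball algebra -/

theorem norm_fderiv_le {E : Type*} [NormedAddCommGroup E] [NormedSpace ℂ E] {G : E → ℂ}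
    (hG : Differentiable ℂ G) {z : E} {r M : ℝ} (hr : 0 < r)
    (hM : ∀ w ∈ Metric.closedBall z r, ‖G w‖ ≤ M) : ‖fderiv ℂ G z‖ ≤ M / r := by
  have hM0 : 0 ≤ M := (norm_nonneg _).trans (hM z (by simpa using hr.le))
  refine ContinuousLinearMap.opNorm_le_bound _ (by positivity) fun u => ?_
  rcases eq_or_ne u 0 with rfl | hu
  · simp
  have hu0 : 0 < ‖u‖ := norm_pos_iff.2 hu
  have hline : HasDerivAt (fun c : ℂ => z + c • u) u 0 := by
    simpa using ((hasDerivAt_id (0 : ℂ)).smul_const u).const_add z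
  have hd : HasDerivAt (fun c : ℂ => G (z + c • u)) (fderiv ℂ G z u) 0 := by
    have := (hG (z + (0 : ℂ) • u)).hasFDerivAt.comp_hasDerivAt (0 : ℂ) hline
    simpa [Function.comp_def] using this
  have h := Complex.norm_deriv_le_of_forall_mem_sphere_norm_le (c := 0) (R := r / ‖u‖) (C := M)
    (f := fun c : ℂ => G (z + c • u)) (by positivity)
    (Differentiable.diffContOnCl (by fun_prop)) fun c hc => hM _ (by
      rw [mem_sphere_zero_iff_norm] at hc
      rw [mem_closedBall_iff_norm, add_sub_cancel_left, norm_smul, hc,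
        div_mul_cancel₀ _ hu0.ne'])
  rw [hd.deriv] at h
  refine h.trans (le_of_eq ?_)
  field_simp

/-- The Cauchy estimate `norm_fderiv_le`, applied to differences `G m - G n`, makes the derivatives
uniformly Cauchy on a smaller ball. Their limits exist because the dual space is complete, and
derivatives then pass to the limit. -/
theorem differentiableOn_of_tendstoUniformlyOn {E : Type*} [NormedAddCommGroup E]
    [NormedSpace ℂ E] {G : ℕ → E → ℂ} {g : E → ℂ} {s : Set E} (hs : IsOpen s)
    (hG : ∀ n, Differentiable ℂ (G n)) (h : TendstoUniformlyOn G g atTop s) :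
    DifferentiableOn ℂ g s := by
  intro z hz
  obtain ⟨r, hr, hrs⟩ := Metric.isOpen_iff.1 hs z hz
  have hsub : ∀ x ∈ Metric.ball z (r / 2), ∀ w ∈ Metric.closedBall x (r / 3), w ∈ s := by
    intro x hx w hw
    refine hrs ?_
    rw [Metric.mem_ball] at hx ⊢
    rw [Metric.mem_closedBall] at hw
    linarith [dist_triangle w x z]
  have hC : UniformCauchySeqOn (fun n => fderiv ℂ (G n)) atTop (Metric.ball z (r / 2)) := by
    rw [Metric.uniformCauchySeqOn_iff]
    intro ε hε
    obtain ⟨N, hN⟩ := Metric.uniformCauchySeqOn_iff.1 h.uniformCauchySeqOn (ε * (r / 6))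
      (by positivity)
    refine ⟨N, fun m hm n hn x hx => ?_⟩
    have h1 := norm_fderiv_le ((hG m).sub (hG n)) (z := x) (r := r / 3) (M := ε * (r / 6))
      (by positivity) fun w hw => by
        rw [Pi.sub_apply, ← dist_eq_norm]
        exact (hN m hm n hn w (hsub x hx w hw)).le
    rw [fderiv_sub (hG m x) (hG n x), ← dist_eq_norm] at h1
    refine h1.trans_lt ?_
    rw [div_lt_iff₀ (by positivity)]
    nlinarith
  have hlim : ∀ x, ∃ L : E →L[ℂ] ℂ, x ∈ Metric.ball z (r / 2) →
      Tendsto (fun n => fderiv ℂ (G n) x) atTop (𝓝 L) := by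
    intro x
    by_cases hx : x ∈ Metric.ball z (r / 2)
    · obtain ⟨L, hL⟩ := cauchySeq_tendsto_of_complete (hC.cauchySeq hx)
      exact ⟨L, fun _ => hL⟩
    · exact ⟨0, fun h => absurd h hx⟩
  choose g' hg' using hlim
  have hzmem : z ∈ Metric.ball z (r / 2) := Metric.mem_ball_self (by positivity)
  have := hasFDerivAt_of_tendstoUniformlyOn Metric.isOpen_ball
    (hC.tendstoUniformlyOn_of_tendsto hg') (fun n x _ => (hG n x).hasFDerivAt)
    (fun x hx => h.tendsto_at (hsub x hx x (Metric.mem_closedBall_self (by positivity)))) hzmem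
  exact this.differentiableAt.differentiableWithinAt

/-- Evaluation at a coordinate, as a continuous linear functional on `c₀`. -/
noncomputable def coordinate (i : ℕ) : C₀(ℕ, ℂ) →L[ℂ] ℂ :=
  LinearMap.mkContinuous
    { toFun := fun z => z i, map_add' := fun _ _ => rfl, map_smul' := fun _ _ => rfl } 1
    fun z => by simpa using norm_apply_le z i

theorem differentiable_eval (p : MvPolynomial ℕ ℂ) :
    Differentiable ℂ fun z : C₀(ℕ, ℂ) => MvPolynomial.eval z p := by
  induction p using MvPolynomial.induction_on with
  | C a => simp
  | add p q hp hq =>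
    simp only [map_add]
    exact hp.add hq
  | mul_X p i hp =>
    simp only [map_mul, MvPolynomial.eval_X]
    exact hp.mul (coordinate i).differentiable

theorem isCompact_polydisc : IsCompact (Set.univ.pi fun _ : ℕ => Metric.closedBall (0 : ℂ) 1) :=
  isCompact_univ_pi fun _ => isCompact_closedBall _ _

/-- A polynomial is continuous on the compact infinite polydisc, hence uniformly continuous there.
The lemma serves both the ball and the half-plane. -/
theorem uniformContinuous_eval {X : Type*} [UniformSpace X] {u : X → ℕ → ℂ}
    (hu : ∀ j, UniformContinuous fun x => u x j) (hu1 : ∀ x j, ‖u x j‖ ≤ 1)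
    (p : MvPolynomial ℕ ℂ) : UniformContinuous fun x => MvPolynomial.eval (u x) p := by
  have h := isCompact_polydisc.uniformContinuousOn_of_continuous
    (MvPolynomial.continuous_eval p).continuousOn
  have hmem : ∀ x, u x ∈ Set.univ.pi fun _ : ℕ => Metric.closedBall (0 : ℂ) 1 :=
    fun x j _ => by simpa using hu1 x j
  intro V hV
  have hx := mem_map.1 (uniformContinuous_pi.2 hu (mem_inf_principal.1 (h hV)))
  exact mem_map.2 (mem_of_superset hx fun x hx => hx ⟨hmem _, hmem _⟩)

theorem uniformContinuous_of_near {X : Type*} [UniformSpace X] {f : X → ℂ}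
    (h : ∀ ε > 0, ∃ g : X → ℂ, UniformContinuous g ∧ ∀ x, ‖f x - g x‖ ≤ ε) :
    UniformContinuous f := by
  refine uniformContinuous_of_uniform_approx_of_uniformContinuous fun V hV => ?_
  obtain ⟨ε, hε, hεV⟩ := Metric.mem_uniformity_dist.1 hV
  obtain ⟨g, hg, hfg⟩ := h (ε / 2) (by positivity)
  refine ⟨g, hg, fun x => hεV ?_⟩
  rw [dist_eq_norm]
  linarith [hfg x]

theorem norm_ballC0_apply_lt (z : BallC0) (j : ℕ) : ‖(z : C₀(ℕ, ℂ)) j‖ < 1 :=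
  (norm_apply_le _ j).trans_lt (mem_ball_zero_iff.1 z.2)

theorem eval_mem_ballSubmodule (p : MvPolynomial ℕ ℂ) :
    (fun z : BallC0 => MvPolynomial.eval (z : C₀(ℕ, ℂ)) p) ∈ ballSubmodule :=
  ⟨uniformContinuous_eval (fun j => (coordinate j).uniformContinuous.comp
      uniformContinuous_subtype_val) (fun z j => (norm_ballC0_apply_lt z j).le) p,
    _, (differentiable_eval p).differentiableOn, fun _ => rfl⟩

theorem mem_ballSubmodule_of_near {f : BallC0 → ℂ} (h : ∀ ε > 0, ∃ p : MvPolynomial ℕ ℂ,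
    ∀ z : BallC0, ‖f z - MvPolynomial.eval (z : C₀(ℕ, ℂ)) p‖ ≤ ε) : f ∈ ballSubmodule := by
  classical
  refine ⟨uniformContinuous_of_near fun ε hε => ?_, fun z => if hz : z ∈ Metric.ball 0 1 then
    f ⟨z, hz⟩ else 0, ?_, fun z => by simp⟩
  · obtain ⟨p, hp⟩ := h ε hε
    exact ⟨_, (eval_mem_ballSubmodule p).1, hp⟩
  · choose p hp using fun n : ℕ => h (1 / (n + 1 : ℝ)) (by positivity)
    refine differentiableOn_of_tendstoUniformlyOn
      (G := fun n (z : C₀(ℕ, ℂ)) => MvPolynomial.eval z (p n)) Metric.isOpen_ball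
      (fun n => differentiable_eval (p n)) ?_
    rw [Metric.tendstoUniformlyOn_iff]
    intro ε hε
    filter_upwards [tendsto_one_div_add_atTop_nhds_zero_nat.eventually_lt_const hε] with n hn z hz
    rw [dist_eq_norm, dif_pos hz]
    exact (hp n ⟨z, hz⟩).trans_lt hn

/-! ### A rapidly decreasing kernel with compactly supported Fourier transform -/


/-- `K` is a rapidly decreasing function whose Fourier transform `φ` is supported in `[-1, 1]`,
with `φ 0 = 1` and nonzero mean. -/
structure IsKernel (K φ : ℝ → ℂ) : Prop where
  continuous : Continuous K
  integrable : Integrable K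
  integrable_mul : Integrable fun t => |t| * ‖K t‖
  bounded : ∃ C, ∀ t, ‖K t‖ ≤ C ∧ |t| * ‖K t‖ ≤ C
  fourier : ∀ x : ℝ, ∫ t, K t * Complex.exp ((-(t * x) : ℝ) * Complex.I) = φ x
  map_zero : φ 0 = 1
  map_eq_zero : ∀ x, 1 ≤ |x| → φ x = 0
  continuous_fourier : Continuous φ
  mean_ne_zero : ∫ x in (-1)..1, φ x ≠ 0

open Real in
theorem exists_kernel : ∃ K φ, IsKernel K φ := by
  -- `K` is the inverse Fourier transform of a bump. The radius `1 / (2 * π)` becomes `1` once the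
  -- exponent `-2πitx` of the Fourier transform is rescaled to `-itx`.
  let b : ContDiffBump (0 : ℝ) := ⟨(4 * π)⁻¹, (2 * π)⁻¹, by positivity,
    inv_strictAnti₀ (by positivity) (by linarith [pi_pos])⟩
  have hb : HasCompactSupport fun w => (b w : ℂ) :=
    b.hasCompactSupport.comp_left (g := fun x : ℝ => (x : ℂ)) Complex.ofReal_zero
  let S : SchwartzMap ℝ ℂ := hb.toSchwartzMap (Complex.ofRealCLM.contDiff.comp b.contDiff)
  let K : SchwartzMap ℝ ℂ := FourierTransformInv.fourierInv S
  have hK : FourierTransform.fourier K = S := FourierTransform.fourier_fourierInv_eq S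
  have hπ : (0 : ℝ) < 2 * π := by positivity
  refine ⟨K, fun x => (b (x / (2 * π)) : ℂ), K.continuous, K.integrable, ?_, ?_, ?_, ?_, ?_,
    Complex.continuous_ofReal.comp (b.continuous.comp (continuous_id.div_const _)), ?_⟩
  · simpa using K.integrable_pow_mul volume 1
  · obtain ⟨C₀, -, h0⟩ := K.decay 0 0
    obtain ⟨C₁, -, h1⟩ := K.decay 1 0
    refine ⟨max C₀ C₁, fun t => ⟨(le_of_eq ?_).trans ((h0 t).trans (le_max_left _ _)),
      (le_of_eq ?_).trans ((h1 t).trans (le_max_right _ _))⟩⟩ <;> simp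
  · intro x
    have h : FourierTransform.fourier (K : ℝ → ℂ) (x / (2 * π)) = (b (x / (2 * π)) : ℂ) := by
      rw [← SchwartzMap.fourier_coe, hK]
      rfl
    rw [← h, Real.fourier_eq']
    refine integral_congr_ae (Eventually.of_forall fun t => ?_)
    simp only [smul_eq_mul]
    rw [mul_comm]
    congr 4
    simp only [RCLike.inner_apply, conj_trivial]
    field_simp
  · simp [b.one_of_mem_closedBall (Metric.mem_closedBall_self b.rIn_pos.le)]
  · intro x hx
    rw [b.zero_of_le_dist, Complex.ofReal_zero]
    change (2 * π)⁻¹ ≤ dist (x / (2 * π)) 0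
    rw [dist_zero_right, norm_eq_abs, abs_div, abs_of_pos hπ, inv_eq_one_div]
    gcongr
  · rw [intervalIntegral.integral_ofReal]
    refine Complex.ofReal_ne_zero.2 (ne_of_gt ?_)
    refine intervalIntegral.intervalIntegral_pos_of_pos_on
      (Continuous.intervalIntegrable (b.continuous.comp (continuous_id.div_const _)) _ _)
      (fun x hx => b.pos_of_mem_ball ?_) (by norm_num)
    change x / (2 * π) ∈ Metric.ball 0 (2 * π)⁻¹
    rw [mem_ball_zero_iff, norm_eq_abs, abs_div, abs_of_pos hπ, inv_eq_one_div,
      div_lt_div_iff_of_pos_right hπ]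
    exact abs_lt.2 hx

theorem norm_phase (x : ℝ) : ‖Complex.exp ((x : ℂ) * Complex.I)‖ = 1 :=
  Complex.norm_exp_ofReal_mul_I x

/-! ### Averages of Dirichlet sums along vertical lines -/

/-- A partial sum of the Dirichlet series with coefficients `a`. -/
noncomputable def dirichletSum (a : ℕ → ℂ) (N : ℕ) (s : ℂ) : ℂ :=
  ∑ n ∈ Finset.Icc 1 N, a n * (n : ℂ) ^ (-s)

theorem natCast_cpow_vertical {n : ℕ} (hn : 0 < n) (s : ℂ) (t : ℝ) :
    (n : ℂ) ^ (-(s + t * Complex.I)) =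
      (n : ℂ) ^ (-s) * Complex.exp ((-(t * Real.log n) : ℝ) * Complex.I) := by
  have hn' : (n : ℂ) ≠ 0 := Nat.cast_ne_zero.2 hn.ne'
  rw [neg_add, Complex.cpow_add _ _ hn', Complex.cpow_def_of_ne_zero hn' (-(t * Complex.I)),
    ← Complex.natCast_log]
  congr 2
  push_cast
  ring

/-- On vertical lines `n ^ (-it)` is the character of frequency `log n`, so averaging is a Fourier
multiplier. Suitable kernels `k` isolate one coefficient, truncate the sum, or smooth it. -/
theorem integral_dirichletSum {k : ℝ → ℂ} (hk : Integrable k) (a : ℕ → ℂ) (N : ℕ) (s : ℂ) (r : ℝ) :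
    ∫ t, k t * dirichletSum a N (s + (r * t : ℝ) * Complex.I) =
      ∑ n ∈ Finset.Icc 1 N, a n * (n : ℂ) ^ (-s) *
        ∫ t, k t * Complex.exp ((-(t * (r * Real.log n)) : ℝ) * Complex.I) := by
  have h : ∀ t, k t * dirichletSum a N (s + (r * t : ℝ) * Complex.I) =
      ∑ n ∈ Finset.Icc 1 N, a n * (n : ℂ) ^ (-s) *
        (k t * Complex.exp ((-(t * (r * Real.log n)) : ℝ) * Complex.I)) := by
    intro t
    rw [dirichletSum, Finset.mul_sum]
    refine Finset.sum_congr rfl fun n hn => ?_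
    rw [natCast_cpow_vertical (Finset.mem_Icc.1 hn).1,
      show r * t * Real.log n = t * (r * Real.log n) by ring]
    ring
  simp_rw [h]
  rw [integral_finsetSum]
  · simp_rw [integral_const_mul]
  · intro n _
    refine Integrable.const_mul ?_ _
    refine hk.mul_bdd (c := 1) (Continuous.aestronglyMeasurable (by fun_prop)) ?_
    exact Eventually.of_forall fun t => (norm_phase _).le

theorem log_sub_log_ge {m n : ℕ} (hm : 0 < m) (hmn : m < n) :
    1 / (n : ℝ) ≤ Real.log n - Real.log m := by
  have hm' : (0 : ℝ) < m := Nat.cast_pos.2 hm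
  have hn' : (0 : ℝ) < n := Nat.cast_pos.2 (hm.trans hmn)
  have hmn' : (m : ℝ) + 1 ≤ n := by exact_mod_cast hmn
  rw [← Real.log_div hn'.ne' hm'.ne']
  refine le_trans ?_ (Real.one_sub_inv_le_log_of_pos (by positivity))
  rw [inv_div, div_le_iff₀ hn', sub_mul, div_mul_cancel₀ _ hn'.ne']
  linarith

theorem norm_integral_dirichletSum_le {k : ℝ → ℂ} {a : ℕ → ℂ} {N : ℕ} {M : ℝ}
    (hk : Integrable k) (hM : ∀ s : ℂ, 0 < s.re → ‖dirichletSum a N s‖ ≤ M) {s : ℂ} (hs : 0 < s.re)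
    (r : ℝ) : ‖∫ t, k t * dirichletSum a N (s + (r * t : ℝ) * Complex.I)‖ ≤ M * ∫ t, ‖k t‖ := by
  rw [← integral_const_mul]
  refine norm_integral_le_of_norm_le (hk.norm.const_mul M) (Eventually.of_forall fun t => ?_)
  rw [norm_mul, mul_comm]
  refine mul_le_mul_of_nonneg_right (hM _ ?_) (norm_nonneg _)
  rwa [Complex.add_re, Complex.re_ofReal_mul, Complex.I_re, mul_zero, add_zero]

variable {K φ : ℝ → ℂ}

/-- The coefficients of a Dirichlet polynomial are bounded by its supremum. -/
theorem IsKernel.norm_coeff_le (hK : IsKernel K φ) {a : ℕ → ℂ} {N : ℕ} {M : ℝ}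
    (hM : ∀ s : ℂ, 0 < s.re → ‖dirichletSum a N s‖ ≤ M) {n : ℕ} (hn : n ∈ Finset.Icc 1 N) :
    ‖a n‖ ≤ M * ∫ t, ‖K t‖ := by
  have hn1 : 0 < n := (Finset.mem_Icc.1 hn).1
  -- The logarithms of distinct integers up to `N` are at least `1 / N` apart. Scaling by `r` pushes
  -- every frequency except `log n` out of the support of `φ` recentred there.
  set r : ℝ := N + 1 with hr
  have hr0 : 0 < r := by positivity
  let k : ℝ → ℂ := fun t => K t * Complex.exp ((t * (r * Real.log n) : ℝ) * Complex.I)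
  have hk : Integrable k :=
    hK.integrable.mul_bdd (c := 1) (Continuous.aestronglyMeasurable (by fun_prop))
      (Eventually.of_forall fun t => (norm_phase _).le)
  have hknorm : ∀ t, ‖k t‖ = ‖K t‖ := fun t => by rw [norm_mul, norm_phase, mul_one]
  have hkφ : ∀ m : ℕ, ∫ t, k t * Complex.exp ((-(t * (r * Real.log m)) : ℝ) * Complex.I) =
      φ (r * (Real.log m - Real.log n)) := by
    intro m
    rw [← hK.fourier]
    refine integral_congr_ae (Eventually.of_forall fun t => ?_)
    simp only [k]
    rw [mul_assoc, ← Complex.exp_add]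
    congr 2
    push_cast
    ring
  have hbound : ∀ s : ℂ, 0 < s.re → ‖a n‖ * (n : ℝ) ^ (-s.re) ≤ M * ∫ t, ‖K t‖ := by
    intro s hs
    have h := norm_integral_dirichletSum_le hk hM hs r
    rw [integral_dirichletSum hk] at h
    simp_rw [hkφ, hknorm] at h
    rw [Finset.sum_eq_single_of_mem n hn] at h
    · rwa [sub_self, mul_zero, hK.map_zero, mul_one, norm_mul,
        Complex.norm_natCast_cpow_of_pos hn1, Complex.neg_re] at h
    · intro m hm hmn
      rw [hK.map_eq_zero, mul_zero]
      have hm1 := Finset.mem_Icc.1 hm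
      have hn2 := Finset.mem_Icc.1 hn
      rw [abs_mul, abs_of_pos hr0]
      have key : ∀ i j : ℕ, 0 < i → i < j → j ≤ N → 1 ≤ r * (Real.log j - Real.log i) := by
        intro i j hi hij hj
        have h1 := log_sub_log_ge hi hij
        have hj0 : (0 : ℝ) < j := Nat.cast_pos.2 (hi.trans hij)
        have hj' : (j : ℝ) ≤ r := by
          rw [hr]
          exact_mod_cast hj.trans (Nat.le_succ N)
        calc (1 : ℝ) = j * (1 / j) := by field_simp
          _ ≤ r * (Real.log j - Real.log i) := by gcongr
      rcases lt_or_gt_of_ne hmn with hlt | hlt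
      · rw [abs_sub_comm]
        exact (key m n hm1.1 hlt hn2.2).trans (mul_le_mul_of_nonneg_left (le_abs_self _) hr0.le)
      · exact (key n m hn1 hlt hm1.2).trans (mul_le_mul_of_nonneg_left (le_abs_self _) hr0.le)
  have hlim : Tendsto (fun σ : ℝ => ‖a n‖ * (n : ℝ) ^ (-σ)) (𝓝[>] 0)
      (𝓝 (‖a n‖ * (n : ℝ) ^ (-0 : ℝ))) := by
    refine Tendsto.mono_left (Continuous.tendsto ?_ 0) nhdsWithin_le_nhds
    exact continuous_const.mul ((Real.continuous_const_rpow
      (Nat.cast_ne_zero.2 hn1.ne')).comp continuous_neg)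
  rw [neg_zero, Real.rpow_zero, mul_one] at hlim
  refine le_of_tendsto hlim ?_
  filter_upwards [self_mem_nhdsWithin] with σ hσ
  simpa using hbound (σ : ℂ) (by simpa using hσ)

/-! ### Summation by parts -/

theorem sum_mul_eq_sum_by_parts (c f : ℕ → ℂ) (N : ℕ) :
    ∑ n ∈ Finset.Icc 1 N, c n * f n = (∑ n ∈ Finset.Icc 1 N, c n) * f (N + 1) +
      ∑ n ∈ Finset.Icc 1 N, (∑ m ∈ Finset.Icc 1 n, c m) * (f n - f (n + 1)) := by
  induction N with
  | zero => simp
  | succ N ih =>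
    rw [Finset.sum_Icc_succ_top (by omega), Finset.sum_Icc_succ_top (by omega),
      Finset.sum_Icc_succ_top (by omega), ih, Finset.sum_Icc_succ_top (by omega)]
    ring

theorem norm_cpow_sub_cpow_succ_le {w : ℂ} (hw : 0 < w.re) {n : ℕ} (hn : 0 < n) :
    ‖(n : ℂ) ^ (-w) - ((n + 1 : ℕ) : ℂ) ^ (-w)‖ ≤ ‖w‖ * (n : ℝ) ^ (-w.re - 1) := by
  have hn0 : (0 : ℝ) < n := Nat.cast_pos.2 hn
  have hw0 : -w ≠ 0 := by
    rintro h
    rw [neg_eq_zero] at h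
    simp [h] at hw
  have h := Convex.norm_image_sub_le_of_norm_hasDerivWithin_le (s := Set.Icc (n : ℝ) (n + 1))
    (f := fun y : ℝ => (y : ℂ) ^ (-w)) (f' := fun y : ℝ => -w * (y : ℂ) ^ (-w - 1))
    (C := ‖w‖ * (n : ℝ) ^ (-w.re - 1)) (x := n + 1) (y := n)
    (fun x hx => (hasDerivAt_ofReal_cpow_const (hn0.trans_le hx.1).ne' hw0).hasDerivWithinAt)
    (fun x hx => by
      have hx0 : 0 < x := hn0.trans_le hx.1
      rw [norm_mul, norm_neg, Complex.norm_cpow_eq_rpow_re_of_pos hx0, Complex.sub_re,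
        Complex.neg_re, Complex.one_re]
      refine mul_le_mul_of_nonneg_left ?_ (norm_nonneg _)
      exact Real.rpow_le_rpow_of_nonpos hn0 hx.1 (by linarith))
    (convex_Icc _ _) (by simp) (by simp)
  simpa using h

/-- Summation by parts: growth `N ^ δ` of the partial sums is absorbed by `n ^ (-w)` when `δ <
w.re`. The bound is only linear in `‖w‖`, which later controls growth along vertical lines. -/
theorem norm_sum_mul_cpow_le {c : ℕ → ℂ} {B δ : ℝ} (hδ : 0 ≤ δ)
    (hB : ∀ N, ‖∑ n ∈ Finset.Icc 1 N, c n‖ ≤ B * (N : ℝ) ^ δ) {w : ℂ} (hw : δ < w.re) (N : ℕ) :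
    ‖∑ n ∈ Finset.Icc 1 N, c n * (n : ℂ) ^ (-w)‖ ≤
      B * (1 + ‖w‖ * ∑' n : ℕ, (n : ℝ) ^ (δ - w.re - 1)) := by
  have hB0 : 0 ≤ B := by simpa using (norm_nonneg _).trans (hB 1)
  have hsum : Summable fun n : ℕ => (n : ℝ) ^ (δ - w.re - 1) :=
    Real.summable_nat_rpow.2 (by linarith)
  rw [sum_mul_eq_sum_by_parts c fun n => (n : ℂ) ^ (-w), mul_add, mul_one]
  refine (norm_add_le _ _).trans (add_le_add ?_ ?_)
  · have hN : (1 : ℝ) ≤ (N + 1 : ℕ) := by exact_mod_cast Nat.succ_le_succ (Nat.zero_le N)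
    rw [norm_mul, Complex.norm_natCast_cpow_of_pos (Nat.succ_pos N), Complex.neg_re]
    calc _ ≤ B * ((N + 1 : ℕ) : ℝ) ^ δ * ((N + 1 : ℕ) : ℝ) ^ (-w.re) := by
          gcongr
          refine (hB N).trans ?_
          gcongr
          simp
      _ = B * ((N + 1 : ℕ) : ℝ) ^ (δ - w.re) := by
          rw [mul_assoc, ← Real.rpow_add (by linarith)]
          rfl
      _ ≤ B * 1 := by
          gcongr
          exact Real.rpow_le_one_of_one_le_of_nonpos hN (by linarith)
      _ = B := mul_one B
  · calc _ ≤ ∑ n ∈ Finset.Icc 1 N, B * ‖w‖ * (n : ℝ) ^ (δ - w.re - 1) := by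
          refine norm_sum_le_of_le _ fun n hn => ?_
          have hn1 : 0 < n := (Finset.mem_Icc.1 hn).1
          rw [norm_mul]
          calc _ ≤ B * (n : ℝ) ^ δ * (‖w‖ * (n : ℝ) ^ (-w.re - 1)) :=
                mul_le_mul (hB n) (norm_cpow_sub_cpow_succ_le (hδ.trans_lt hw) hn1)
                  (norm_nonneg _) (by positivity)
            _ = B * ‖w‖ * ((n : ℝ) ^ δ * (n : ℝ) ^ (-w.re - 1)) := by ring
            _ = _ := by
                rw [← Real.rpow_add (Nat.cast_pos.2 hn1)]
                ring_nf
      _ = B * ‖w‖ * ∑ n ∈ Finset.Icc 1 N, (n : ℝ) ^ (δ - w.re - 1) := by rw [Finset.mul_sum]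
      _ ≤ B * ‖w‖ * ∑' n : ℕ, (n : ℝ) ^ (δ - w.re - 1) := by
          gcongr
          exact hsum.sum_le_tsum _ fun n _ => by positivity
      _ = _ := by ring

/-! ### Partial sums of Dirichlet polynomials -/

/-- The Fourier transform of the indicator function of `[-A, A]`. -/
noncomputable def boxTransform (A t : ℝ) : ℂ :=
  ∫ y in (-A)..A, Complex.exp ((t * y : ℝ) * Complex.I)

theorem norm_boxTransform_le {A : ℝ} (hA : 0 ≤ A) (t : ℝ) : ‖boxTransform A t‖ ≤ 2 * A := by
  have h := intervalIntegral.norm_integral_le_of_norm_le_const (a := -A) (b := A) (C := 1)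
    (f := fun y : ℝ => Complex.exp ((t * y : ℝ) * Complex.I)) fun y _ => (norm_phase _).le
  rw [sub_neg_eq_add, abs_of_nonneg (by linarith)] at h
  exact h.trans (le_of_eq (by ring))

theorem abs_mul_norm_boxTransform_le (A t : ℝ) : |t| * ‖boxTransform A t‖ ≤ 2 := by
  rcases eq_or_ne t 0 with rfl | ht
  · simp
  have hc : (t : ℂ) * Complex.I ≠ 0 := mul_ne_zero (Complex.ofReal_ne_zero.2 ht) Complex.I_ne_zero
  have h : boxTransform A t = (Complex.exp (t * Complex.I * (A : ℝ)) -
      Complex.exp (t * Complex.I * (-A : ℝ))) / (t * Complex.I) := by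
    rw [← integral_exp_mul_complex hc, boxTransform]
    refine intervalIntegral.integral_congr fun y _ => ?_
    congr 1
    push_cast
    ring
  have hph : ∀ B : ℝ, ‖Complex.exp (t * Complex.I * (B : ℝ))‖ = 1 := fun B => by
    rw [show (t : ℂ) * Complex.I * (B : ℝ) = (t * B : ℝ) * Complex.I by push_cast; ring, norm_phase]
  rw [h, norm_div, norm_mul, Complex.norm_I, mul_one, Complex.norm_real, Real.norm_eq_abs,
    mul_div_cancel₀ _ (abs_ne_zero.2 ht)]
  refine (norm_sub_le _ _).trans ?_
  rw [hph, hph]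
  norm_num

theorem continuous_boxTransform (A : ℝ) : Continuous (boxTransform A) :=
  intervalIntegral.continuous_parametric_intervalIntegral_of_continuous' (by fun_prop) _ _

/-- For `|t| ≤ 1` the box transform is at most `2 * A`. For larger `t` it is at most `2 / |t|`, and
the kernel contributes a further `(η * |t|) ^ (-δ)`. The result is an integrable majorant at the
price `A + η ^ (-δ)`. -/
theorem IsKernel.norm_mul_boxTransform_le (hK : IsKernel K φ) {δ : ℝ} (hδ : 0 < δ) (hδ1 : δ ≤ 1) :
    ∃ C, 0 < C ∧ ∀ A η t : ℝ, 0 ≤ A → 0 < η →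
      ‖K (η * t) * boxTransform A t‖ ≤ C * (A + η ^ (-δ)) * (1 + ‖t‖) ^ (-(1 + δ)) := by
  obtain ⟨C, hC⟩ := hK.bounded
  have hC0 : 0 ≤ C := (norm_nonneg _).trans (hC 0).1
  refine ⟨8 * (C + 1), by positivity, fun A η t hA hη => ?_⟩
  have hη' : 0 < η ^ (-δ) := Real.rpow_pos_of_pos hη _
  have ht1 : 0 < 1 + ‖t‖ := by positivity
  have h4 : (2 : ℝ) ^ (1 + δ) ≤ 4 := by
    calc (2 : ℝ) ^ (1 + δ) ≤ 2 ^ (2 : ℝ) :=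
          Real.rpow_le_rpow_of_exponent_le (by norm_num) (by linarith)
      _ = 4 := by norm_num
  rw [norm_mul, Real.rpow_neg ht1.le, ← div_eq_mul_inv, le_div_iff₀ (Real.rpow_pos_of_pos ht1 _)]
  rcases le_or_gt ‖t‖ 1 with h1 | h1
  · calc ‖K (η * t)‖ * ‖boxTransform A t‖ * (1 + ‖t‖) ^ (1 + δ)
        ≤ C * (2 * A) * 2 ^ (1 + δ) := by
          gcongr
          · exact (hC _).1
          · exact norm_boxTransform_le hA t
          · linarith
      _ ≤ C * (2 * A) * 4 := by gcongr
      _ ≤ 8 * (C + 1) * (A + η ^ (-δ)) := by nlinarith [mul_nonneg hC0 hη'.le]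
  · have ht0 : 0 < ‖t‖ := by linarith
    -- Interpolation between the bounds for `‖K x‖` and `|x| * ‖K x‖`.
    have hKd : ‖K (η * t)‖ * (η * ‖t‖) ^ δ ≤ C := by
      have habs : |η * t| = η * ‖t‖ := by rw [abs_mul, abs_of_pos hη, Real.norm_eq_abs]
      rcases le_or_gt (η * ‖t‖) 1 with h | h
      · calc _ ≤ ‖K (η * t)‖ * 1 := by
              gcongr
              exact Real.rpow_le_one (by positivity) h hδ.le
          _ ≤ C := by rw [mul_one]; exact (hC _).1
      · calc _ ≤ ‖K (η * t)‖ * (η * ‖t‖) := by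
              gcongr
              exact (Real.rpow_le_rpow_of_exponent_le h.le hδ1).trans (Real.rpow_one _).le
          _ ≤ C := by rw [mul_comm, ← habs]; exact (hC _).2
    rw [Real.mul_rpow hη.le ht0.le] at hKd
    have hJ : ‖t‖ * ‖boxTransform A t‖ ≤ 2 := abs_mul_norm_boxTransform_le A t
    have hηη : η ^ δ * η ^ (-δ) = 1 := by rw [← Real.rpow_add hη]; simp
    calc ‖K (η * t)‖ * ‖boxTransform A t‖ * (1 + ‖t‖) ^ (1 + δ)
        ≤ ‖K (η * t)‖ * ‖boxTransform A t‖ * (2 * ‖t‖) ^ (1 + δ) := by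
          gcongr
          linarith
      _ = (‖K (η * t)‖ * (η ^ δ * ‖t‖ ^ δ)) * (‖t‖ * ‖boxTransform A t‖) * 2 ^ (1 + δ) *
            η ^ (-δ) := by
          rw [Real.mul_rpow (by norm_num) ht0.le, Real.rpow_add ht0, Real.rpow_one]
          linear_combination (-(‖K (η * t)‖ * ‖boxTransform A t‖ * 2 ^ (1 + δ) *
            (‖t‖ * ‖t‖ ^ δ))) * hηη
      _ ≤ C * 2 * 4 * η ^ (-δ) := by gcongr
      _ ≤ 8 * (C + 1) * (A + η ^ (-δ)) := by nlinarith [mul_nonneg hC0 hA]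

/-- By Fubini the transform of the product is the indicator of `[-A, A]` convolved with `φ` rescaled
to width `η`: a smoothed cutoff, constant well inside the interval and zero well outside. -/
theorem IsKernel.fourier_mul_boxTransform (hK : IsKernel K φ) {A η : ℝ} (hA : 0 ≤ A) (hη : 0 < η)
    (x : ℝ) : ∫ t, K (η * t) * boxTransform A t * Complex.exp ((-(t * x) : ℝ) * Complex.I) =
      ∫ u in ((x - A) / η)..((x + A) / η), φ u := by
  have hinteg : Integrable (Function.uncurry fun t y : ℝ =>
      K (η * t) * Complex.exp ((-(t * (x - y)) : ℝ) * Complex.I))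
      (volume.prod (volume.restrict (Set.Ioc (-A) A))) := by
    have h1 : Integrable (fun z : ℝ × ℝ => K (η * z.1) * 1)
        (volume.prod (volume.restrict (Set.Ioc (-A) A))) :=
      (hK.integrable.comp_mul_left' hη.ne').mul_prod (integrable_const (1 : ℂ))
    simp only [mul_one] at h1
    exact h1.mul_bdd (c := 1) (Continuous.aestronglyMeasurable (by fun_prop))
      (Eventually.of_forall fun z => (norm_phase _).le)
  have hinner : ∀ y : ℝ, ∫ t, K (η * t) * Complex.exp ((-(t * (x - y)) : ℝ) * Complex.I) =
      (η⁻¹ : ℝ) • φ (x / η - y / η) := by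
    intro y
    have h := Measure.integral_comp_mul_left
      (fun u : ℝ => K u * Complex.exp ((-(u * (x / η - y / η)) : ℝ) * Complex.I)) η
    rw [hK.fourier, abs_of_pos (inv_pos.2 hη)] at h
    rw [← h]
    refine integral_congr_ae (Eventually.of_forall fun t => ?_)
    dsimp only
    congr 4
    field_simp
  calc _ = ∫ t, ∫ y in Set.Ioc (-A) A,
        K (η * t) * Complex.exp ((-(t * (x - y)) : ℝ) * Complex.I) := by
        refine integral_congr_ae (Eventually.of_forall fun t => ?_)
        dsimp only
        rw [boxTransform, mul_assoc, intervalIntegral.integral_of_le (by linarith),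
          ← integral_mul_const, ← integral_const_mul]
        refine integral_congr_ae (Eventually.of_forall fun y => ?_)
        dsimp only
        rw [← Complex.exp_add]
        congr 2
        push_cast
        ring
    _ = ∫ y in Set.Ioc (-A) A, (η⁻¹ : ℝ) • φ (x / η - y / η) := by
        rw [integral_integral_swap hinteg]
        simp_rw [hinner]
    _ = _ := by
        rw [integral_smul, ← intervalIntegral.integral_of_le (by linarith),
          intervalIntegral.integral_comp_sub_div φ hη.ne', smul_smul, inv_mul_cancel₀ hη.ne',
          one_smul, neg_div, sub_neg_eq_add, ← sub_div, ← add_div]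

theorem IsKernel.intervalIntegral_eq_zero (hK : IsKernel K φ) {u v : ℝ} (huv : u ≤ v)
    (h : 1 ≤ u ∨ v ≤ -1) : ∫ x in u..v, φ x = 0 := by
  rw [← intervalIntegral.integral_zero (a := u) (b := v)]
  refine intervalIntegral.integral_congr fun x hx => hK.map_eq_zero x ?_
  rw [Set.uIcc_of_le huv] at hx
  rcases h with h | h
  · exact (h.trans hx.1).trans (le_abs_self x)
  · rw [le_abs]
    right
    linarith [hx.2]

theorem IsKernel.intervalIntegral_eq (hK : IsKernel K φ) {u v : ℝ} (hu : u ≤ -1) (hv : 1 ≤ v) :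
    ∫ x in u..v, φ x = ∫ x in (-1)..1, φ x := by
  have hi : ∀ a b, IntervalIntegrable φ volume a b :=
    fun a b => hK.continuous_fourier.intervalIntegrable a b
  rw [← intervalIntegral.integral_add_adjacent_intervals (hi u (-1)) (hi (-1) v),
    ← intervalIntegral.integral_add_adjacent_intervals (hi (-1) 1) (hi 1 v),
    hK.intervalIntegral_eq_zero hu (Or.inr le_rfl), hK.intervalIntegral_eq_zero hv (Or.inl le_rfl),
    zero_add, add_zero]

/-- With `A` midway between `log L` and `log (L + 1)` and `η` half their gap, the smoothed cutoff
equals `c` at every `log n` with `1 ≤ n ≤ L` and vanishes for `n > L`. The average is thus exactly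
`c` times the partial sum. Its cost is `O(L ^ δ)`, because `A` is logarithmic in `L` and `η ≥ 1 / (4
* L)`. -/
theorem IsKernel.norm_dirichletSum_le (hK : IsKernel K φ) {δ : ℝ} (hδ : 0 < δ) (hδ1 : δ ≤ 1) :
    ∃ C, 0 < C ∧ ∀ (a : ℕ → ℂ) (N : ℕ) (M : ℝ), (∀ s : ℂ, 0 < s.re → ‖dirichletSum a N s‖ ≤ M) →
      ∀ L ≤ N, ∀ s : ℂ, 0 < s.re → ‖dirichletSum a L s‖ ≤ C * M * (L : ℝ) ^ δ := by
  obtain ⟨C, hC0, hC⟩ := hK.norm_mul_boxTransform_le hδ hδ1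
  set c := ∫ x in (-1)..1, φ x with hc
  have hc0 : 0 < ‖c‖ := norm_pos_iff.2 hK.mean_ne_zero
  have hjap : Integrable fun t : ℝ => (1 + ‖t‖) ^ (-(1 + δ)) :=
    integrable_one_add_norm (by simpa using hδ)
  set I := ∫ t : ℝ, (1 + ‖t‖) ^ (-(1 + δ)) with hI
  have hI0 : 0 ≤ I := integral_nonneg fun t => by positivity
  refine ⟨C * (2 / δ + 4) * (I + 1) / ‖c‖, by positivity, fun a N M hM L hLN s hs => ?_⟩
  have hM0 : 0 ≤ M := (norm_nonneg _).trans (hM s hs)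
  rcases Nat.eq_zero_or_pos L with rfl | hL
  · simp only [dirichletSum, Finset.Icc_eq_empty (by norm_num : ¬ (1 ≤ 0)), Finset.sum_empty,
      norm_zero]
    positivity
  have hL1 : (1 : ℝ) ≤ L := by exact_mod_cast hL
  have hgap := log_sub_log_ge hL (Nat.lt_succ_self L)
  have hlog0 : 0 ≤ Real.log L := Real.log_nonneg hL1
  have hgap0 : 0 < 1 / ((L + 1 : ℕ) : ℝ) := by positivity
  set η := (Real.log (L + 1 : ℕ) - Real.log L) / 2 with hη
  set A := (Real.log (L + 1 : ℕ) + Real.log L) / 2 with hA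
  have hη0 : 0 < η := by rw [hη]; linarith
  have hA0 : 0 ≤ A := by rw [hA]; linarith
  let k : ℝ → ℂ := fun t => K (η * t) * boxTransform A t
  have hkint : Integrable k := by
    refine (hjap.const_mul (C * (A + η ^ (-δ)))).mono'
      (Continuous.aestronglyMeasurable ?_) (Eventually.of_forall fun t => hC A η t hA0 hη0)
    exact (hK.continuous.comp (continuous_const.mul continuous_id)).mul (continuous_boxTransform A)
  have hknorm : ∫ t, ‖k t‖ ≤ C * (A + η ^ (-δ)) * I := by
    rw [hI, ← integral_const_mul]
    exact integral_mono hkint.norm (hjap.const_mul _) fun t => hC A η t hA0 hη0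
  have hsum : ∫ t, k t * dirichletSum a N (s + (1 * t : ℝ) * Complex.I) =
      c * dirichletSum a L s := by
    rw [integral_dirichletSum hkint, dirichletSum, Finset.mul_sum]
    rw [← Finset.sum_subset (Finset.Icc_subset_Icc_right hLN)]
    · refine Finset.sum_congr rfl fun n hn => ?_
      obtain ⟨hn1, hnL⟩ := Finset.mem_Icc.1 hn
      have hn1' : (1 : ℝ) ≤ n := by exact_mod_cast hn1
      have hlogn : Real.log n ≤ Real.log L :=
        Real.log_le_log (by linarith) (by exact_mod_cast hnL)
      have hlogn0 := Real.log_nonneg hn1'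
      rw [one_mul, hK.fourier_mul_boxTransform hA0 hη0, hK.intervalIntegral_eq, mul_comm]
      · rw [div_le_iff₀ hη0, hA, hη]
        linarith
      · rw [le_div_iff₀ hη0, hA, hη]
        linarith
    · intro n hn hnL
      obtain ⟨hn1, hnN⟩ := Finset.mem_Icc.1 hn
      have hLn : L + 1 ≤ n := by
        by_contra hcon
        exact hnL (Finset.mem_Icc.2 ⟨hn1, by omega⟩)
      have hlogn : Real.log (L + 1 : ℕ) ≤ Real.log n :=
        Real.log_le_log (by positivity) (by exact_mod_cast hLn)
      rw [one_mul, hK.fourier_mul_boxTransform hA0 hη0, hK.intervalIntegral_eq_zero, mul_zero]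
      · gcongr
        linarith
      · left
        rw [le_div_iff₀ hη0, hA, hη]
        linarith
  have hmain := norm_integral_dirichletSum_le hkint hM hs 1
  rw [hsum, norm_mul] at hmain
  have hlogL : A ≤ 2 / δ * (L : ℝ) ^ δ := by
    have h2L : ((L + 1 : ℕ) : ℝ) ≤ 2 * L := by push_cast; linarith
    have h1 : A ≤ Real.log (2 * L) := by
      have := Real.log_le_log (by positivity) h2L
      have := Real.log_le_log (by positivity : (0 : ℝ) < L) (by linarith : (L : ℝ) ≤ 2 * L)
      rw [hA]
      linarith
    calc A ≤ (2 * L : ℝ) ^ δ / δ := h1.trans (Real.log_le_rpow_div (by positivity) hδ)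
      _ = (2 : ℝ) ^ δ * (L : ℝ) ^ δ / δ := by rw [Real.mul_rpow (by norm_num) (by positivity)]
      _ ≤ 2 * (L : ℝ) ^ δ / δ := by
        gcongr
        exact (Real.rpow_le_rpow_of_exponent_le (by norm_num) hδ1).trans (Real.rpow_one 2).le
      _ = _ := by ring
  have hηL : η ^ (-δ) ≤ 4 * (L : ℝ) ^ δ := by
    have h1 : (4 * L : ℝ)⁻¹ ≤ η := by
      have h2 : (4 * L : ℝ)⁻¹ ≤ 1 / ((L + 1 : ℕ) : ℝ) / 2 := by
        rw [div_div, ← one_div]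
        refine one_div_le_one_div_of_le (by positivity) ?_
        push_cast
        linarith
      rw [hη]
      linarith
    calc η ^ (-δ) ≤ ((4 * L : ℝ)⁻¹) ^ (-δ) :=
          Real.rpow_le_rpow_of_nonpos (by positivity) h1 (by linarith)
      _ = (4 : ℝ) ^ δ * (L : ℝ) ^ δ := by
        rw [Real.inv_rpow (by positivity), Real.rpow_neg (by positivity), inv_inv,
          Real.mul_rpow (by norm_num) (by positivity)]
      _ ≤ 4 * (L : ℝ) ^ δ := by
        gcongr
        exact (Real.rpow_le_rpow_of_exponent_le (by norm_num) hδ1).trans (Real.rpow_one 4).le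
  have hLδ : 0 < (L : ℝ) ^ δ := by positivity
  rw [div_mul_eq_mul_div, div_mul_eq_mul_div, le_div_iff₀ hc0, mul_comm]
  calc _ ≤ M * ∫ t, ‖k t‖ := hmain
    _ ≤ M * (C * (2 / δ * (L : ℝ) ^ δ + 4 * (L : ℝ) ^ δ) * (I + 1)) := by
      gcongr
      refine hknorm.trans ?_
      gcongr
      linarith
    _ = _ := by ring

/-- The partial sums of a Dirichlet polynomial at a point of the half-plane are bounded by the
supremum of the polynomial. -/
theorem exists_norm_dirichletSum_le {s : ℂ} (hs : 0 < s.re) :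
    ∃ C, 0 < C ∧ ∀ (a : ℕ → ℂ) (N : ℕ) (M : ℝ), (∀ s : ℂ, 0 < s.re → ‖dirichletSum a N s‖ ≤ M) →
      ∀ L ≤ N, ‖dirichletSum a L s‖ ≤ C * M := by
  obtain ⟨K, φ, hK⟩ := exists_kernel
  -- The loss `L ^ δ` occurs at `s - w`, still in the half-plane; multiplying the terms by `n ^
  -- (-w)` returns to `s` and removes it, since `δ ≤ s.re / 4 < w.re`.
  set w : ℂ := ((s.re / 2 : ℝ) : ℂ) with hw
  have hwre : w.re = s.re / 2 := Complex.ofReal_re _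
  obtain ⟨C, hC0, hC⟩ := hK.norm_dirichletSum_le (δ := min 1 (s.re / 4))
    (lt_min one_pos (by linarith)) (min_le_left _ _)
  have hδ : min 1 (s.re / 4) < w.re := (min_le_right _ _).trans_lt (by rw [hwre]; linarith)
  have hT : 0 ≤ ∑' n : ℕ, (n : ℝ) ^ (min 1 (s.re / 4) - w.re - 1) :=
    tsum_nonneg fun n => by positivity
  refine ⟨C * (1 + ‖w‖ * ∑' n : ℕ, (n : ℝ) ^ (min 1 (s.re / 4) - w.re - 1)), by positivity,
    fun a N M hM L hL => ?_⟩
  have hsw : 0 < (s - w).re := by rw [Complex.sub_re, hwre]; linarith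
  have hM0 : 0 ≤ M := (norm_nonneg _).trans (hM s hs)
  -- Cutting the coefficients off at `L` makes the growth bound valid for all partial sums, although
  -- it is known only up to length `N`.
  let c : ℕ → ℂ := fun n => if n ≤ L then a n * (n : ℂ) ^ (-(s - w)) else 0
  have hB : ∀ n, ‖∑ m ∈ Finset.Icc 1 n, c m‖ ≤ C * M * (n : ℝ) ^ min 1 (s.re / 4) := by
    intro n
    have h1 : ∑ m ∈ Finset.Icc 1 n, c m = dirichletSum a (min n L) (s - w) := by
      rw [dirichletSum, ← Finset.sum_filter]
      refine Finset.sum_congr ?_ fun _ _ => rfl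
      ext m
      simp [and_assoc]
    rw [h1]
    refine (hC a N M hM _ ((min_le_right _ _).trans hL) _ hsw).trans ?_
    exact mul_le_mul_of_nonneg_left (Real.rpow_le_rpow (by positivity)
      (by exact_mod_cast min_le_left n L) (le_min zero_le_one (by linarith))) (by positivity)
  have h := norm_sum_mul_cpow_le (le_min zero_le_one (by linarith)) hB hδ L
  have h2 : ∑ n ∈ Finset.Icc 1 L, c n * (n : ℂ) ^ (-w) = dirichletSum a L s := by
    refine Finset.sum_congr rfl fun n hn => ?_
    obtain ⟨hn1, hnL⟩ := Finset.mem_Icc.1 hn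
    simp only [c, if_pos hnL]
    rw [mul_assoc, ← Complex.cpow_add _ _ (Nat.cast_ne_zero.2 (by omega))]
    congr 2
    ring
  rw [h2] at h
  exact h.trans (le_of_eq (by ring))

/-! ### Monomials and integers -/

/-- The point `(p_j ^ (-s))_j`. -/
noncomputable def primeVec (s : ℂ) (j : ℕ) : ℂ := (Nat.nth Nat.Prime j : ℂ) ^ (-s)

theorem nth_prime_injective : Function.Injective (Nat.nth Nat.Prime) :=
  Nat.nth_injective Nat.infinite_setOfPred_prime

theorem nth_prime (j : ℕ) : (Nat.nth Nat.Prime j).Prime :=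
  Nat.nth_mem_of_infinite Nat.infinite_setOfPred_prime j

theorem primePow_ne_zero (d : ℕ →₀ ℕ) : primePow d ≠ 0 :=
  Finset.prod_ne_zero_iff.2 fun j _ => pow_ne_zero _ (nth_prime j).ne_zero

theorem primePow_eq (d : ℕ →₀ ℕ) :
    primePow d = (d.mapDomain (Nat.nth Nat.Prime)).prod fun p k => p ^ k :=
  (Finsupp.prod_mapDomain_index_inj nth_prime_injective).symm

theorem primePow_injective : Function.Injective primePow := by
  have h : ∀ d, (primePow d).factorization = d.mapDomain (Nat.nth Nat.Prime) := by
    intro d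
    rw [primePow_eq]
    refine Nat.prod_pow_factorization_eq_self fun p hp => ?_
    obtain ⟨j, -, rfl⟩ := Finset.mem_image.1 (Finsupp.mapDomain_support hp)
    exact nth_prime j
  intro d e hde
  refine Finsupp.mapDomain_injective nth_prime_injective ?_
  rw [← h, ← h, hde]

/-- The exponents of the primes in the factorization of `n`. -/
noncomputable def exponents (n : ℕ) : ℕ →₀ ℕ :=
  n.factorization.comapDomain (Nat.nth Nat.Prime) nth_prime_injective.injOn

theorem primePow_exponents {n : ℕ} (hn : n ≠ 0) : primePow (exponents n) = n := by
  rw [primePow_eq, exponents, Finsupp.mapDomain_comapDomain _ nth_prime_injective]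
  · exact Nat.prod_factorization_pow_eq_self hn
  · intro p hp
    rw [Nat.range_nth_of_infinite Nat.infinite_setOfPred_prime]
    exact Nat.prime_of_mem_primeFactors (by simpa using hp)

theorem exponents_primePow (d : ℕ →₀ ℕ) : exponents (primePow d) = d :=
  primePow_injective (primePow_exponents (primePow_ne_zero d))

theorem eval_monomial_primeVec (s : ℂ) (d : ℕ →₀ ℕ) (c : ℂ) :
    MvPolynomial.eval (primeVec s) (MvPolynomial.monomial d c) = c * (primePow d : ℂ) ^ (-s) := by
  let χ : ℕ →* ℂ :=
    { toFun := fun n => (n : ℂ) ^ (-s)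
      map_one' := by simp
      map_mul' := fun m n => by rw [Nat.cast_mul, Complex.natCast_mul_natCast_cpow] }
  rw [MvPolynomial.eval_monomial]
  congr 1
  change _ = χ (primePow d)
  rw [primePow, map_finsuppProd]
  exact Finset.prod_congr rfl fun j _ => (map_pow χ _ _).symm

/-- The `n`-th Dirichlet coefficient of a polynomial. -/
noncomputable def coeffAt (p : MvPolynomial ℕ ℂ) (n : ℕ) : ℂ := p.coeff (exponents n)

theorem exists_eval_primeVec_eq (p : MvPolynomial ℕ ℂ) : ∃ N₀, ∀ N ≥ N₀, ∀ s,
    MvPolynomial.eval (primeVec s) p = dirichletSum (coeffAt p) N s := by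
  refine ⟨p.support.sup primePow, fun N hN s => ?_⟩
  have h1 : MvPolynomial.eval (primeVec s) p =
      ∑ d ∈ p.support, coeffAt p (primePow d) * (primePow d : ℂ) ^ (-s) := by
    conv_lhs => rw [p.as_sum, map_sum]
    refine Finset.sum_congr rfl fun d _ => ?_
    rw [eval_monomial_primeVec, coeffAt, exponents_primePow]
  rw [h1, ← Finset.sum_image (f := fun n : ℕ => coeffAt p n * (n : ℂ) ^ (-s))
    primePow_injective.injOn]
  refine Finset.sum_subset (fun n hn => ?_) fun n hn hnp => ?_
  · obtain ⟨d, hd, rfl⟩ := Finset.mem_image.1 hn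
    exact Finset.mem_Icc.2 ⟨Nat.pos_of_ne_zero (primePow_ne_zero d),
      (Finset.le_sup (f := primePow) hd).trans hN⟩
  · rw [coeffAt, MvPolynomial.notMem_support_iff.1, zero_mul]
    intro hmem
    refine hnp (Finset.mem_image.2 ⟨_, hmem, primePow_exponents ?_⟩)
    have := (Finset.mem_Icc.1 hn).1
    omega

theorem eval_primeVec_sum (a : ℕ → ℂ) (N : ℕ) (s : ℂ) : MvPolynomial.eval (primeVec s)
    (∑ n ∈ Finset.Icc 1 N, MvPolynomial.monomial (exponents n) (a n)) = dirichletSum a N s := by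
  rw [map_sum]
  refine Finset.sum_congr rfl fun n hn => ?_
  have := (Finset.mem_Icc.1 hn).1
  rw [eval_monomial_primeVec, primePow_exponents (by omega)]

theorem dirichletSum_coeffAt_sub (p q : MvPolynomial ℕ ℂ) (N : ℕ) (s : ℂ) :
    dirichletSum (coeffAt (p - q)) N s =
      dirichletSum (coeffAt p) N s - dirichletSum (coeffAt q) N s := by
  simp only [dirichletSum, coeffAt, MvPolynomial.coeff_sub, sub_mul, Finset.sum_sub_distrib]

/-! ### Estimates for polynomials on the half-plane -/

/-- The constant `∫ ‖K‖` does not depend on the polynomial or its length, as the argument with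
powers `p ^ k` requires. -/
theorem exists_norm_coeffAt_le : ∃ C, 0 ≤ C ∧ ∀ (p : MvPolynomial ℕ ℂ) (M : ℝ),
    (∀ s : HalfPlane, ‖MvPolynomial.eval (primeVec s) p‖ ≤ M) →
      ∀ n, 1 ≤ n → ‖coeffAt p n‖ ≤ C * M := by
  obtain ⟨K, φ, hK⟩ := exists_kernel
  refine ⟨∫ t, ‖K t‖, integral_nonneg fun t => norm_nonneg _, fun p M hM n hn => ?_⟩
  obtain ⟨N₀, hN₀⟩ := exists_eval_primeVec_eq p
  rw [mul_comm]
  refine hK.norm_coeff_le (N := max N₀ n) (fun s hs => ?_)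
    (Finset.mem_Icc.2 ⟨hn, le_max_right _ _⟩)
  rw [← hN₀ _ (le_max_left _ _)]
  exact hM ⟨s, hs⟩

theorem exists_norm_dirichletSum_coeffAt_le (s : HalfPlane) : ∃ C, 0 < C ∧
    ∀ (p : MvPolynomial ℕ ℂ) (M : ℝ),
      (∀ s : HalfPlane, ‖MvPolynomial.eval (primeVec s) p‖ ≤ M) →
        ∀ L, ‖dirichletSum (coeffAt p) L s‖ ≤ C * M := by
  obtain ⟨C, hC0, hC⟩ := exists_norm_dirichletSum_le s.2
  refine ⟨C, hC0, fun p M hM L => ?_⟩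
  obtain ⟨N₀, hN₀⟩ := exists_eval_primeVec_eq p
  refine hC _ (max N₀ L) M (fun s hs => ?_) L (le_max_right _ _)
  rw [← hN₀ _ (le_max_left _ _)]
  exact hM ⟨s, hs⟩

theorem norm_primeVec_le (s : HalfPlane) (j : ℕ) : ‖primeVec s j‖ ≤ (2 : ℝ) ^ (-(s : ℂ).re) := by
  rw [primeVec, Complex.norm_natCast_cpow_of_pos (nth_prime j).pos, Complex.neg_re]
  exact Real.rpow_le_rpow_of_nonpos (by norm_num) (by exact_mod_cast (nth_prime j).two_le)
    (by linarith [s.2])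

theorem two_rpow_neg_lt_one (s : HalfPlane) : (2 : ℝ) ^ (-(s : ℂ).re) < 1 :=
  Real.rpow_lt_one_of_one_lt_of_neg (by norm_num) (by linarith [s.2])

theorem uniformContinuous_primeVec (j : ℕ) :
    UniformContinuous fun s : HalfPlane => primeVec s j := by
  have hp := nth_prime j
  set n := Nat.nth Nat.Prime j with hn
  have hn0 : (n : ℂ) ≠ 0 := Nat.cast_ne_zero.2 hp.ne_zero
  have hd : ∀ s : ℂ, HasDerivAt (fun s : ℂ => (n : ℂ) ^ (-s))
      ((n : ℂ) ^ (-s) * Complex.log n * -1) s := fun s =>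
    (hasDerivAt_neg s).const_cpow (Or.inl hn0)
  have hLip : ∀ s t : HalfPlane, dist (primeVec s j) (primeVec t j) ≤
      ‖Complex.log n‖ * dist s t := by
    intro s t
    rw [dist_eq_norm, Subtype.dist_eq, dist_eq_norm]
    refine Convex.norm_image_sub_le_of_norm_hasDerivWithin_le (s := {s : ℂ | 0 < s.re})
      (fun x _ => (hd x).hasDerivWithinAt) (fun x hx => ?_) (convex_halfSpace_re_gt 0) t.2 s.2
    rw [norm_mul, norm_mul, norm_neg, norm_one, mul_one]
    refine mul_le_of_le_one_left (norm_nonneg _) ?_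
    exact (norm_primeVec_le ⟨x, hx⟩ j).trans (two_rpow_neg_lt_one ⟨x, hx⟩).le
  exact (LipschitzWith.of_dist_le' hLip).uniformContinuous

theorem uniformContinuous_eval_primeVec (p : MvPolynomial ℕ ℂ) :
    UniformContinuous fun s : HalfPlane => MvPolynomial.eval (primeVec s) p :=
  uniformContinuous_eval uniformContinuous_primeVec
    (fun s j => (norm_primeVec_le s j).trans (two_rpow_neg_lt_one s).le) p

/-! ### Uniform limits of Dirichlet polynomials belong to the Dirichlet algebra -/

/-- The coefficients of approximating polynomials converge by the uniform coefficient bound. At each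
`s` the partial-sum bound is uniform in `N`, so the partial sums of the limiting series stay close
to those of `p k`, which eventually equal the value of `p k` at `s`. -/
theorem mem_dirichletSubmodule_of_near {f : HalfPlane → ℂ} (h : ∀ ε > 0, ∃ p : MvPolynomial ℕ ℂ,
    ∀ s : HalfPlane, ‖f s - MvPolynomial.eval (primeVec s) p‖ ≤ ε) : f ∈ dirichletSubmodule := by
  refine ⟨?_, uniformContinuous_of_near fun ε hε => ?_⟩
  swap
  · obtain ⟨p, hp⟩ := h ε hε
    exact ⟨_, uniformContinuous_eval_primeVec p, hp⟩
  choose p hp using fun k : ℕ => h (1 / (k + 1 : ℝ)) (by positivity)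
  have hdiff : ∀ k l, k ≤ l → ∀ s : HalfPlane,
      ‖MvPolynomial.eval (primeVec s) (p l - p k)‖ ≤ 2 * (1 / (k + 1 : ℝ)) := by
    intro k l hkl s
    have h1 := hp k s
    have h2 := hp l s
    have h3 : 1 / (l + 1 : ℝ) ≤ 1 / (k + 1 : ℝ) :=
      one_div_le_one_div_of_le (by positivity) (by gcongr)
    rw [map_sub]
    calc _ = ‖(f s - MvPolynomial.eval (primeVec s) (p k)) -
          (f s - MvPolynomial.eval (primeVec s) (p l))‖ := by congr 1; ring
      _ ≤ _ := norm_sub_le _ _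
      _ ≤ _ := by linarith
  have hto : Tendsto (fun k : ℕ => 1 / (k + 1 : ℝ)) atTop (𝓝 0) :=
    tendsto_one_div_add_atTop_nhds_zero_nat
  obtain ⟨C, hC0, hC⟩ := exists_norm_coeffAt_le
  have hcoeff : ∀ n, ∃ a, 1 ≤ n → Tendsto (fun k => coeffAt (p k) n) atTop (𝓝 a) := by
    intro n
    by_cases hn : 1 ≤ n
    · have hcau : CauchySeq fun k => coeffAt (p k) n := by
        refine cauchySeq_of_le_tendsto_0 (fun k : ℕ => 2 * (C * (2 * (1 / (k + 1 : ℝ)))))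
          (fun l m N hl hm => ?_) (by simpa using ((hto.const_mul 2).const_mul C).const_mul 2)
        have key : ∀ i, N ≤ i → ‖coeffAt (p i) n - coeffAt (p N) n‖ ≤
            C * (2 * (1 / (N + 1 : ℝ))) := by
          intro i hi
          have := hC (p i - p N) _ (hdiff N i hi) n hn
          rwa [coeffAt, MvPolynomial.coeff_sub] at this
        rw [dist_eq_norm]
        calc _ = ‖(coeffAt (p l) n - coeffAt (p N) n) - (coeffAt (p m) n - coeffAt (p N) n)‖ := by
              congr 1; ring
          _ ≤ _ := norm_sub_le _ _
          _ ≤ _ := by linarith [key l hl, key m hm]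
      obtain ⟨a, ha⟩ := cauchySeq_tendsto_of_complete hcau
      exact ⟨a, fun _ => ha⟩
    · exact ⟨0, fun h => absurd h hn⟩
  choose a ha using hcoeff
  refine ⟨a, fun s => ?_⟩
  change Tendsto (fun N => dirichletSum a N s) atTop (𝓝 (f s))
  obtain ⟨B, hB0, hB⟩ := exists_norm_dirichletSum_coeffAt_le s
  have hpart : ∀ k N, ‖dirichletSum a N s - dirichletSum (coeffAt (p k)) N s‖ ≤
      B * (2 * (1 / (k + 1 : ℝ))) := by
    intro k N
    have hlim : Tendsto (fun l => dirichletSum (coeffAt (p l)) N s) atTop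
        (𝓝 (dirichletSum a N s)) :=
      tendsto_finsetSum _ fun n hn => (ha n (Finset.mem_Icc.1 hn).1).mul_const _
    refine le_of_tendsto (hlim.sub_const _).norm ?_
    filter_upwards [eventually_ge_atTop k] with l hl
    rw [← dirichletSum_coeffAt_sub]
    exact hB _ _ (hdiff k l hl) N
  rw [Metric.tendsto_atTop]
  intro ε hε
  have hto2 : Tendsto (fun k : ℕ => B * (2 * (1 / (k + 1 : ℝ))) + 1 / (k + 1 : ℝ)) atTop (𝓝 0) := by
    simpa using ((hto.const_mul 2).const_mul B).add hto
  obtain ⟨k, hk⟩ := (hto2.eventually_lt_const hε).exists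
  obtain ⟨N₀, hN₀⟩ := exists_eval_primeVec_eq (p k)
  refine ⟨N₀, fun N hN => ?_⟩
  have h1 := hpart k N
  have h2 := hp k s
  rw [hN₀ N hN s, norm_sub_rev] at h2
  rw [dist_eq_norm]
  calc _ = ‖(dirichletSum a N s - dirichletSum (coeffAt (p k)) N s) +
        (dirichletSum (coeffAt (p k)) N s - f s)‖ := by congr 1; ring
    _ ≤ _ := norm_add_le _ _
    _ < ε := by linarith

/-! ### Dirichlet polynomials are dense in the Dirichlet algebra -/

/-- The vertical translate of a point of the half-plane. -/
def HalfPlane.shift (s : HalfPlane) (h : ℝ) : HalfPlane :=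
  ⟨s + h * Complex.I, by simpa using s.2⟩

theorem HalfPlane.continuous_shift (s : HalfPlane) : Continuous s.shift :=
  Continuous.subtype_mk (by fun_prop) _

theorem HalfPlane.dist_shift (s : HalfPlane) (h : ℝ) : dist s (s.shift h) = |h| := by
  rw [Subtype.dist_eq, dist_eq_norm]
  change ‖(s : ℂ) - (s + h * Complex.I)‖ = |h|
  simp

/-- Convergence at `s₁` bounds the partial sums there; summation by parts with `δ = 0` transfers
this to the line through `s`. Linear growth in `|h|` is integrable against the kernel. -/
theorem exists_norm_dirichletSum_vertical_le {a : ℕ → ℂ} {f : HalfPlane → ℂ}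
    (ha : HasDirichletSeries a f) (s : HalfPlane) :
    ∃ C, ∀ (N : ℕ) (h : ℝ), ‖dirichletSum a N (s + h * Complex.I)‖ ≤ C * (1 + |h|) := by
  have hσ : 0 < (s : ℂ).re / 2 := half_pos s.2
  let s₁ : HalfPlane := ⟨((s : ℂ).re / 2 : ℝ), by rwa [Complex.ofReal_re]⟩
  obtain ⟨B, hB⟩ := (ha s₁).norm.bddAbove_range
  have hB0 : 0 ≤ B := (norm_nonneg _).trans (hB ⟨0, rfl⟩)
  set T := ∑' n : ℕ, (n : ℝ) ^ (0 - (s : ℂ).re / 2 - 1) with hT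
  have hT0 : 0 ≤ T := tsum_nonneg fun n => by positivity
  set W := ‖(s : ℂ) - s₁‖ with hW
  refine ⟨B * (1 + (W + 1) * T), fun N h => ?_⟩
  let w : ℂ := (s : ℂ) - s₁ + h * Complex.I
  have hwre : w.re = (s : ℂ).re / 2 := by
    have : ((s₁ : ℂ)).re = (s : ℂ).re / 2 := Complex.ofReal_re _
    simp only [w, Complex.add_re, Complex.sub_re, this, Complex.re_ofReal_mul, Complex.I_re]
    ring
  have hb := norm_sum_mul_cpow_le (c := fun n => a n * (n : ℂ) ^ (-(s₁ : ℂ))) (B := B) (δ := 0)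
    le_rfl (fun N => by rw [Real.rpow_zero, mul_one]; exact hB ⟨N, rfl⟩) (w := w)
    (by rw [hwre]; exact hσ) N
  rw [hwre, ← hT] at hb
  have hsum : ∑ n ∈ Finset.Icc 1 N, a n * (n : ℂ) ^ (-(s₁ : ℂ)) * (n : ℂ) ^ (-w) =
      dirichletSum a N (s + h * Complex.I) := by
    refine Finset.sum_congr rfl fun n hn => ?_
    have := (Finset.mem_Icc.1 hn).1
    rw [mul_assoc, ← Complex.cpow_add _ _ (Nat.cast_ne_zero.2 (by omega))]
    congr 2
    simp only [w]
    ring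
  rw [hsum] at hb
  refine hb.trans ?_
  have hw : ‖w‖ ≤ W + |h| := (norm_add_le _ _).trans (by simp [hW])
  have hW0 : 0 ≤ W := norm_nonneg _
  rw [mul_assoc]
  refine mul_le_mul_of_nonneg_left ?_ hB0
  have h1 : ‖w‖ * T ≤ (W + |h|) * T := by gcongr
  nlinarith [abs_nonneg h, mul_nonneg hW0 hT0, mul_nonneg (mul_nonneg hW0 hT0) (abs_nonneg h),
    mul_nonneg hT0 (abs_nonneg h)]

/-- The series need not converge absolutely, so dominated convergence is applied to its partial
sums. Their averages no longer change beyond `N₀`, where `φ` kills all frequencies. -/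
theorem IsKernel.integral_shift_eq {K φ : ℝ → ℂ} (hK : IsKernel K φ) {a : ℕ → ℂ}
    {f : HalfPlane → ℂ} (ha : HasDirichletSeries a f) {r : ℝ} (hr : 0 < r) (s : HalfPlane) {N₀ : ℕ}
    (hN₀ : ∀ n : ℕ, N₀ < n → 1 ≤ r * Real.log n) :
    ∫ t, K t * f (s.shift (r * t)) =
      dirichletSum (fun n => a n * φ (r * Real.log n)) N₀ s := by
  obtain ⟨C, hC⟩ := exists_norm_dirichletSum_vertical_le ha s
  have hC0 : 0 ≤ C := by simpa using (norm_nonneg _).trans (hC 0 0)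
  have hlim : Tendsto (fun N => ∫ t, K t * dirichletSum a N (s + (r * t : ℝ) * Complex.I)) atTop
      (𝓝 (∫ t, K t * f (s.shift (r * t)))) := by
    refine tendsto_integral_of_dominated_convergence
      (fun t => C * ‖K t‖ + C * r * (|t| * ‖K t‖)) (fun N => ?_) ?_ (fun N => ?_) ?_
    · refine Continuous.aestronglyMeasurable (hK.continuous.mul ?_)
      refine continuous_finsetSum _ fun n hn => continuous_const.mul ?_
      have h0 : (n : ℂ) ≠ 0 := Nat.cast_ne_zero.2 (by have := (Finset.mem_Icc.1 hn).1; omega)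
      exact Continuous.const_cpow (by fun_prop) (Or.inl h0)
    · exact (hK.integrable.norm.const_mul C).add (hK.integrable_mul.const_mul _)
    · refine Eventually.of_forall fun t => ?_
      rw [norm_mul]
      have h1 := hC N (r * t)
      rw [abs_mul, abs_of_pos hr] at h1
      calc _ ≤ ‖K t‖ * (C * (1 + r * |t|)) := by gcongr
        _ = _ := by ring
    · exact Eventually.of_forall fun t => (ha (s.shift (r * t))).const_mul (K t)
  refine tendsto_nhds_unique hlim (tendsto_const_nhds.congr' ?_)
  filter_upwards [eventually_ge_atTop N₀] with N hN
  rw [integral_dirichletSum hK.integrable, dirichletSum,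
    Finset.sum_subset (Finset.Icc_subset_Icc_right hN)]
  · refine Finset.sum_congr rfl fun n _ => ?_
    rw [hK.fourier]
    ring
  · intro n hn hnN
    have hn' : N₀ < n := by
      by_contra hcon
      exact hnN (Finset.mem_Icc.2 ⟨(Finset.mem_Icc.1 hn).1, not_lt.1 hcon⟩)
    rw [hK.map_eq_zero _ ((hN₀ n hn').trans (le_abs_self _)), mul_zero, zero_mul]

theorem exists_eval_primeVec_near {f : HalfPlane → ℂ} (hf : f ∈ dirichletSubmodule) {ε : ℝ}
    (hε : 0 < ε) : ∃ p : MvPolynomial ℕ ℂ, ∀ s : HalfPlane,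
      ‖f s - MvPolynomial.eval (primeVec s) p‖ ≤ ε := by
  obtain ⟨M, hM⟩ := bounded_of_mem_dirichletSubmodule f hf
  obtain ⟨⟨a, ha⟩, hu⟩ := hf
  obtain ⟨K, φ, hK⟩ := exists_kernel
  have hM' : ∀ s, ‖f s‖ ≤ M := fun s => hM ⟨s, rfl⟩
  have hM0 : 0 ≤ M := (norm_nonneg _).trans (hM' ⟨1, by simp⟩)
  set I₀ := ∫ t, ‖K t‖ with hI₀
  set I₁ := ∫ t, |t| * ‖K t‖ with hI₁
  have hI₀0 : 0 ≤ I₀ := integral_nonneg fun t => norm_nonneg _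
  have hI₁0 : 0 ≤ I₁ := integral_nonneg fun t => by positivity
  set ε' := ε / (2 * (I₀ + 1)) with hε'
  have hε'0 : 0 < ε' := by positivity
  obtain ⟨δ, hδ, hfδ⟩ := Metric.uniformContinuous_iff.1 hu ε' hε'0
  -- Uniform continuity for `|h| < δ` and boundedness otherwise combine into a bound linear in
  -- `|h|`. Integrated against `‖K‖`, its two terms cost at most `ε / 2` each by the choices of `ε'`
  -- and `r`.
  have hmod : ∀ (s : HalfPlane) (h : ℝ), ‖f s - f (s.shift h)‖ ≤ ε' + 2 * M / δ * |h| := by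
    intro s h
    rcases lt_or_ge |h| δ with hh | hh
    · have := hfδ (a := s) (b := s.shift h) (by rwa [HalfPlane.dist_shift])
      rw [dist_eq_norm] at this
      have h2 : 0 ≤ 2 * M / δ * |h| := by positivity
      linarith
    · have h1 := norm_sub_le (f s) (f (s.shift h))
      have h2 : 2 * M ≤ 2 * M / δ * |h| := by
        rw [div_mul_eq_mul_div, le_div_iff₀ hδ]
        gcongr
      linarith [hM' s, hM' (s.shift h)]
  set r := ε / (2 * (2 * M / δ * I₁ + 1)) with hr
  have hr0 : 0 < r := by positivity
  obtain ⟨N₀, hN₀⟩ := exists_nat_ge (Real.exp (1 / r))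
  have hlog : ∀ n : ℕ, N₀ < n → 1 ≤ r * Real.log n := by
    intro n hn
    have hn' : Real.exp (1 / r) ≤ n := hN₀.trans (by exact_mod_cast hn.le)
    have h1 := (Real.le_log_iff_exp_le ((Real.exp_pos _).trans_le hn')).2 hn'
    rw [div_le_iff₀ hr0] at h1
    linarith
  refine ⟨∑ n ∈ Finset.Icc 1 N₀, MvPolynomial.monomial (exponents n) (a n * φ (r * Real.log n)),
    fun s => ?_⟩
  rw [eval_primeVec_sum (fun n => a n * φ (r * Real.log n)), ← hK.integral_shift_eq ha hr0 s hlog]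
  have hone : ∫ t, K t = 1 := by simpa [hK.map_zero] using hK.fourier 0
  have hmeas : Continuous fun t : ℝ => f (s.shift (r * t)) :=
    hu.continuous.comp (s.continuous_shift.comp (continuous_const.mul continuous_id))
  have hinteg : Integrable fun t => K t * f (s.shift (r * t)) :=
    hK.integrable.mul_bdd (c := M) hmeas.aestronglyMeasurable
      (Eventually.of_forall fun t => hM' _)
  have heq : f s - ∫ t, K t * f (s.shift (r * t)) = ∫ t, K t * (f s - f (s.shift (r * t))) := by
    simp_rw [mul_sub]
    rw [integral_sub (hK.integrable.mul_const _) hinteg, integral_mul_const, hone, one_mul]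
  rw [heq]
  have hbd : ‖∫ t, K t * (f s - f (s.shift (r * t)))‖ ≤
      ∫ t, (ε' * ‖K t‖ + 2 * M / δ * r * (|t| * ‖K t‖)) := by
    refine norm_integral_le_of_norm_le
      ((hK.integrable.norm.const_mul _).add (hK.integrable_mul.const_mul _))
      (Eventually.of_forall fun t => ?_)
    rw [norm_mul]
    have h1 := hmod s (r * t)
    rw [abs_mul, abs_of_pos hr0] at h1
    calc _ ≤ ‖K t‖ * (ε' + 2 * M / δ * (r * |t|)) := by gcongr
      _ = _ := by ring
  rw [integral_add (hK.integrable.norm.const_mul _) (hK.integrable_mul.const_mul _),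
    integral_const_mul, integral_const_mul, ← hI₀, ← hI₁] at hbd
  refine hbd.trans ?_
  have h1 : ε' * I₀ ≤ ε / 2 := by
    calc ε' * I₀ ≤ ε' * (I₀ + 1) := by gcongr; linarith
      _ = ε / 2 := by rw [hε']; field_simp
  have h2 : 2 * M / δ * r * I₁ ≤ ε / 2 := by
    calc 2 * M / δ * r * I₁ = r * (2 * M / δ * I₁) := by ring
      _ ≤ r * (2 * M / δ * I₁ + 1) := by gcongr; linarith
      _ = ε / 2 := by rw [hr]; field_simp
  linarith

/-! ### The suprema over the half-plane and over the ball agree on polynomials -/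

/-- As in an Euler product, expanding the product of the geometric series yields each multi-index
supported in `S` once. -/
theorem sum_prod_pow_le {S : Finset ℕ} {T : Finset (ℕ →₀ ℕ)} (hT : ∀ d ∈ T, d.support ⊆ S)
    {r : ℕ → ℝ} (h0 : ∀ j, 0 ≤ r j) (h1 : ∀ j, r j < 1) :
    ∑ d ∈ T, ∏ j ∈ d.support, r j ^ d j ≤ ∏ j ∈ S, (1 - r j)⁻¹ := by
  classical
  let D := T.sup fun d => S.sup d
  let ρ : (ℕ →₀ ℕ) → S → ℕ := fun d j => d j
  have hρ : Set.InjOn ρ T := by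
    intro d hd e he hde
    ext j
    by_cases hj : j ∈ S
    · exact congrFun hde ⟨j, hj⟩
    · rw [Finsupp.notMem_support_iff.1 fun h => hj (hT d hd h),
        Finsupp.notMem_support_iff.1 fun h => hj (hT e he h)]
  calc ∑ d ∈ T, ∏ j ∈ d.support, r j ^ d j = ∑ d ∈ T, ∏ j : S, r j ^ ρ d j := by
        refine Finset.sum_congr rfl fun d hd => ?_
        rw [Finset.prod_coe_sort S fun j => r j ^ d j]
        refine Finset.prod_subset (hT d hd) fun j _ hj => ?_
        rw [Finsupp.notMem_support_iff.1 hj, pow_zero]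
    _ = ∑ x ∈ T.image ρ, ∏ j : S, r j ^ x j :=
        (Finset.sum_image (f := fun x : S → ℕ => ∏ j : S, r j ^ x j) hρ).symm
    _ ≤ ∑ x ∈ Fintype.piFinset fun _ : S => Finset.range (D + 1), ∏ j : S, r j ^ x j := by
        refine Finset.sum_le_sum_of_subset_of_nonneg (fun x hx => ?_) fun x _ _ =>
          Finset.prod_nonneg fun j _ => pow_nonneg (h0 j) _
        obtain ⟨d, hd, rfl⟩ := Finset.mem_image.1 hx
        rw [Fintype.mem_piFinset]
        intro j
        rw [Finset.mem_range, Nat.lt_succ_iff]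
        exact (Finset.le_sup (f := d) j.2).trans (Finset.le_sup (f := fun d : ℕ →₀ ℕ => S.sup d) hd)
    _ = ∏ j : S, ∑ l ∈ Finset.range (D + 1), r j ^ l :=
        (Finset.prod_univ_sum (fun _ : S => Finset.range (D + 1)) fun j l => r j ^ l).symm
    _ ≤ ∏ j : S, (1 - r j)⁻¹ := by
        refine Finset.prod_le_prod (fun j _ => Finset.sum_nonneg fun l _ => pow_nonneg (h0 j) _)
          fun j _ => ?_
        rw [← tsum_geometric_of_lt_one (h0 j) (h1 j)]
        exact (summable_geometric_of_lt_one (h0 j) (h1 j)).sum_le_tsum _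
          fun l _ => pow_nonneg (h0 j) _
    _ = ∏ j ∈ S, (1 - r j)⁻¹ := Finset.prod_coe_sort S fun j => (1 - r j)⁻¹

theorem le_of_forall_pow_le_mul_pow {x M A : ℝ} (hM : 0 ≤ M)
    (h : ∀ k : ℕ, x ^ k ≤ A * M ^ k) : x ≤ M := by
  by_contra! hcon
  rcases hM.eq_or_lt with rfl | hM
  · have := h 1
    simp only [pow_one, mul_zero] at this
    linarith
  · have ht := tendsto_pow_atTop_atTop_of_one_lt ((one_lt_div hM).2 hcon)
    obtain ⟨k, hk⟩ := (ht.eventually_gt_atTop A).exists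
    rw [div_pow, lt_div_iff₀ (by positivity)] at hk
    linarith [h k]

/-- The coefficient bound for `p ^ k` is `C * M ^ k`. The sum over monomials contributes a product
over `p.vars`, independent of `k` because powers introduce no new variables. Hence `‖p(z)‖ ^ k ≤ A *
M ^ k` for all `k`, which forces the claim. -/
theorem norm_eval_le_of_halfPlane {p : MvPolynomial ℕ ℂ} {M : ℝ}
    (hM : ∀ s : HalfPlane, ‖MvPolynomial.eval (primeVec s) p‖ ≤ M) {z : ℕ → ℂ}
    (hz : ∀ j, ‖z j‖ < 1) : ‖MvPolynomial.eval z p‖ ≤ M := by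
  obtain ⟨C, hC0, hC⟩ := exists_norm_coeffAt_le
  have hM0 : 0 ≤ M := (norm_nonneg _).trans (hM ⟨1, by simp⟩)
  refine le_of_forall_pow_le_mul_pow (A := C * ∏ j ∈ p.vars, (1 - ‖z j‖)⁻¹) hM0 fun k => ?_
  have hcoeff : ∀ d, ‖(p ^ k).coeff d‖ ≤ C * M ^ k := by
    intro d
    have h := hC (p ^ k) (M ^ k) (fun s => by
      rw [map_pow, norm_pow]
      exact pow_le_pow_left₀ (norm_nonneg _) (hM s) k) (primePow d)
      (Nat.pos_of_ne_zero (primePow_ne_zero d))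
    rwa [coeffAt, exponents_primePow] at h
  rw [← norm_pow, ← map_pow, MvPolynomial.eval_eq]
  calc _ ≤ ∑ d ∈ (p ^ k).support, C * M ^ k * ∏ j ∈ d.support, ‖z j‖ ^ d j := by
        refine norm_sum_le_of_le _ fun d _ => ?_
        rw [norm_mul, norm_prod]
        simp only [norm_pow]
        exact mul_le_mul_of_nonneg_right (hcoeff d)
          (Finset.prod_nonneg fun j _ => pow_nonneg (norm_nonneg _) _)
    _ = C * M ^ k * ∑ d ∈ (p ^ k).support, ∏ j ∈ d.support, ‖z j‖ ^ d j := by rw [Finset.mul_sum]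
    _ ≤ C * M ^ k * ∏ j ∈ p.vars, (1 - ‖z j‖)⁻¹ := by
        refine mul_le_mul_of_nonneg_left (sum_prod_pow_le (fun d hd j hj => ?_)
          (fun j => norm_nonneg _) hz) (by positivity)
        exact MvPolynomial.vars_pow p k
          ((MvPolynomial.mem_vars_iff_mem_support j).2 ⟨d, hd, hj⟩)
    _ = _ := by ring

theorem norm_eval_primeVec_le_of_ball {p : MvPolynomial ℕ ℂ} {M : ℝ}
    (hM : ∀ z : BallC0, ‖MvPolynomial.eval (z : C₀(ℕ, ℂ)) p‖ ≤ M) (s : HalfPlane) :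
    ‖MvPolynomial.eval (primeVec s) p‖ ≤ M := by
  have hlim : Tendsto (fun k => (truncate k (primeVec s) : ℕ → ℂ)) atTop (𝓝 (primeVec s)) := by
    refine tendsto_pi_nhds.2 fun j => tendsto_const_nhds.congr' ?_
    filter_upwards [eventually_gt_atTop j] with k hk
    simp [hk]
  refine le_of_tendsto (((MvPolynomial.continuous_eval p).tendsto _).comp hlim).norm
    (Eventually.of_forall fun k => hM ⟨truncate k (primeVec s), ?_⟩)
  rw [mem_ball_zero_iff]
  exact (norm_truncate_le (by positivity) fun j _ => norm_primeVec_le s j).trans_lt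
    (two_rpow_neg_lt_one s)

/-! ### Completeness and the polynomial subalgebras -/

/-- Completeness of both spaces is needed to extend the isometry from polynomials; here it is
reduced to closedness under uniform approximation. -/
theorem completeSpace_of_uniform_limits {V X : Type*} [NormedAddCommGroup V] (ev : V → X → ℂ)
    (hsub : ∀ f g x, ev (f - g) x = ev f x - ev g x) (hle : ∀ f x, ‖ev f x‖ ≤ ‖f‖)
    (hsup : ∀ f M, (∀ x, ‖ev f x‖ ≤ M) → ‖f‖ ≤ M)
    (hclosed : ∀ g : X → ℂ, (∀ ε > 0, ∃ f, ∀ x, ‖g x - ev f x‖ ≤ ε) → ∃ f, ev f = g) :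
    CompleteSpace V := by
  refine Metric.complete_of_cauchySeq_tendsto fun u hu => ?_
  have hpt : ∀ x, ∃ a, Tendsto (fun n => ev (u n) x) atTop (𝓝 a) := fun x => by
    refine cauchySeq_tendsto_of_complete (Metric.cauchySeq_iff.2 fun ε hε => ?_)
    obtain ⟨N, hN⟩ := Metric.cauchySeq_iff.1 hu ε hε
    refine ⟨N, fun m hm n hn => ?_⟩
    rw [dist_eq_norm, ← hsub]
    exact (hle _ x).trans_lt (by simpa [dist_eq_norm] using hN m hm n hn)
  choose g hg using hpt
  have hunif : ∀ ε > 0, ∃ N, ∀ n ≥ N, ∀ x, ‖g x - ev (u n) x‖ ≤ ε := by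
    intro ε hε
    obtain ⟨N, hN⟩ := Metric.cauchySeq_iff.1 hu ε hε
    refine ⟨N, fun n hn x => le_of_tendsto ((hg x).sub_const _).norm ?_⟩
    filter_upwards [eventually_ge_atTop N] with m hm
    rw [← hsub]
    exact (hle _ x).trans (by simpa [dist_eq_norm] using (hN m hm n hn).le)
  obtain ⟨f, hf⟩ := hclosed g fun ε hε =>
    let ⟨N, hN⟩ := hunif ε hε
    ⟨u N, hN N le_rfl⟩
  refine ⟨f, Metric.tendsto_atTop.2 fun ε hε => ?_⟩
  obtain ⟨N, hN⟩ := hunif (ε / 2) (by positivity)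
  refine ⟨N, fun n hn => ?_⟩
  rw [dist_comm, dist_eq_norm]
  refine (hsup _ (ε / 2) fun x => ?_).trans_lt (by linarith)
  rw [hsub, hf]
  exact hN n hn x

namespace DirichletAlgebra

theorem sub_apply (f g : DirichletAlgebra) (s : HalfPlane) : (f - g) s = f s - g s := rfl

theorem norm_apply_le (f : DirichletAlgebra) (s : HalfPlane) : ‖f s‖ ≤ ‖f‖ := by
  rw [norm_def]
  exact le_ciSup (bounded_of_mem_dirichletSubmodule f.1 f.2) s

theorem norm_le {f : DirichletAlgebra} {M : ℝ} (h : ∀ s, ‖f s‖ ≤ M) : ‖f‖ ≤ M := by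
  rw [norm_def]
  exact ciSup_le h

/-- The Dirichlet polynomial obtained by substituting `p_j ^ (-s)` for the `j`-th variable. -/
noncomputable def ofPolynomial : MvPolynomial ℕ ℂ →ₗ[ℂ] DirichletAlgebra where
  toFun p := ⟨fun s => MvPolynomial.eval (primeVec s) p,
    mem_dirichletSubmodule_of_near fun ε hε => ⟨p, fun s => by simpa using hε.le⟩⟩
  map_add' p q := Subtype.ext (funext fun _ => map_add _ p q)
  map_smul' c p := Subtype.ext (funext fun _ => MvPolynomial.smul_eval _ p c)

theorem ofPolynomial_apply (p : MvPolynomial ℕ ℂ) (s : HalfPlane) :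
    ofPolynomial p s = MvPolynomial.eval (primeVec s) p := rfl

theorem exists_norm_sub_ofPolynomial_le (f : DirichletAlgebra) {ε : ℝ} (hε : 0 < ε) :
    ∃ p, ‖f - ofPolynomial p‖ ≤ ε :=
  let ⟨p, hp⟩ := exists_eval_primeVec_near f.2 hε
  ⟨p, norm_le hp⟩

theorem denseRange_ofPolynomial : DenseRange ofPolynomial :=
  Metric.denseRange_iff.2 fun f ε hε =>
    let ⟨p, hp⟩ := exists_norm_sub_ofPolynomial_le f (half_pos hε)
    ⟨p, by rw [dist_eq_norm]; linarith⟩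

theorem exists_of_near {g : HalfPlane → ℂ}
    (h : ∀ ε > 0, ∃ f : DirichletAlgebra, ∀ s, ‖g s - f s‖ ≤ ε) :
    ∃ f : DirichletAlgebra, (f : HalfPlane → ℂ) = g := by
  refine ⟨⟨g, mem_dirichletSubmodule_of_near fun ε hε => ?_⟩, rfl⟩
  obtain ⟨f, hf⟩ := h (ε / 2) (by positivity)
  obtain ⟨p, hp⟩ := exists_norm_sub_ofPolynomial_le f (half_pos hε)
  refine ⟨p, fun s => ?_⟩
  have h1 := (norm_apply_le _ s).trans hp
  rw [sub_apply, ofPolynomial_apply] at h1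
  calc _ = ‖(g s - f s) + (f s - MvPolynomial.eval (primeVec s) p)‖ := by congr 1; ring
    _ ≤ _ := norm_add_le _ _
    _ ≤ ε := by linarith [hf s]

instance : CompleteSpace DirichletAlgebra :=
  completeSpace_of_uniform_limits (fun f s => f s) sub_apply norm_apply_le
    (fun _ _ => norm_le) fun _ => exists_of_near

end DirichletAlgebra

namespace BallAlgebra

theorem sub_apply (f g : BallAlgebra) (z : BallC0) : (f - g) z = f z - g z := rfl

theorem norm_apply_le (f : BallAlgebra) (z : BallC0) : ‖f z‖ ≤ ‖f‖ := by
  rw [norm_def]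
  exact le_ciSup (bounded_of_mem_ballSubmodule f.1 f.2) z

theorem norm_le {f : BallAlgebra} {M : ℝ} (h : ∀ z, ‖f z‖ ≤ M) : ‖f‖ ≤ M := by
  rw [norm_def]
  exact ciSup_le h

/-- A polynomial in finitely many coordinates, as a function on the ball of `c₀`. -/
noncomputable def ofPolynomial : MvPolynomial ℕ ℂ →ₗ[ℂ] BallAlgebra where
  toFun p := ⟨fun z => MvPolynomial.eval (z : C₀(ℕ, ℂ)) p, eval_mem_ballSubmodule p⟩
  map_add' p q := Subtype.ext (funext fun _ => map_add _ p q)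
  map_smul' c p := Subtype.ext (funext fun _ => MvPolynomial.smul_eval _ p c)

theorem ofPolynomial_apply (p : MvPolynomial ℕ ℂ) (z : BallC0) :
    ofPolynomial p z = MvPolynomial.eval (z : C₀(ℕ, ℂ)) p := rfl

theorem exists_norm_sub_ofPolynomial_le (f : BallAlgebra) {ε : ℝ} (hε : 0 < ε) :
    ∃ p, ‖f - ofPolynomial p‖ ≤ ε :=
  let ⟨p, hp⟩ := exists_mvPolynomial_near f.2 hε
  ⟨p, norm_le hp⟩

theorem denseRange_ofPolynomial : DenseRange ofPolynomial :=
  Metric.denseRange_iff.2 fun f ε hε =>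
    let ⟨p, hp⟩ := exists_norm_sub_ofPolynomial_le f (half_pos hε)
    ⟨p, by rw [dist_eq_norm]; linarith⟩

theorem exists_of_near {g : BallC0 → ℂ}
    (h : ∀ ε > 0, ∃ f : BallAlgebra, ∀ z, ‖g z - f z‖ ≤ ε) :
    ∃ f : BallAlgebra, (f : BallC0 → ℂ) = g := by
  refine ⟨⟨g, mem_ballSubmodule_of_near fun ε hε => ?_⟩, rfl⟩
  obtain ⟨f, hf⟩ := h (ε / 2) (by positivity)
  obtain ⟨p, hp⟩ := exists_norm_sub_ofPolynomial_le f (half_pos hε)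
  refine ⟨p, fun z => ?_⟩
  have h1 := (norm_apply_le _ z).trans hp
  rw [sub_apply, ofPolynomial_apply] at h1
  calc _ = ‖(g z - f z) + (f z - MvPolynomial.eval (z : C₀(ℕ, ℂ)) p)‖ := by congr 1; ring
    _ ≤ _ := norm_add_le _ _
    _ ≤ ε := by linarith [hf z]

instance : CompleteSpace BallAlgebra :=
  completeSpace_of_uniform_limits (fun f z => f z) sub_apply norm_apply_le
    (fun _ _ => norm_le) fun _ => exists_of_near

end BallAlgebra

/-! ### The Bohr lift and its multiplicativity. -/

theorem norm_ofPolynomial_eq (p : MvPolynomial ℕ ℂ) :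
    ‖BallAlgebra.ofPolynomial p‖ = ‖DirichletAlgebra.ofPolynomial p‖ :=
  le_antisymm
    (BallAlgebra.norm_le fun z => norm_eval_le_of_halfPlane
      (DirichletAlgebra.norm_apply_le (DirichletAlgebra.ofPolynomial p)) (norm_ballC0_apply_lt z))
    (DirichletAlgebra.norm_le fun s => norm_eval_primeVec_le_of_ball
      (BallAlgebra.norm_apply_le (BallAlgebra.ofPolynomial p)) s)

/-- The Bohr lift. -/
noncomputable def bohrLift : DirichletAlgebra ≃ₗᵢ[ℂ] BallAlgebra :=
  (LinearEquiv.refl ℂ (MvPolynomial ℕ ℂ)).extendOfIsometry DirichletAlgebra.ofPolynomial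
    BallAlgebra.ofPolynomial DirichletAlgebra.denseRange_ofPolynomial
    BallAlgebra.denseRange_ofPolynomial norm_ofPolynomial_eq

theorem bohrLift_ofPolynomial (p : MvPolynomial ℕ ℂ) :
    bohrLift (DirichletAlgebra.ofPolynomial p) = BallAlgebra.ofPolynomial p :=
  LinearMap.extendOfNorm_eq DirichletAlgebra.denseRange_ofPolynomial
    ⟨1, fun x => by rw [one_mul]; exact (norm_ofPolynomial_eq x).le⟩ p

theorem norm_mul_sub_mul_le (a b c d : ℂ) :
    ‖a * b - c * d‖ ≤ ‖a - c‖ * ‖b‖ + ‖c‖ * ‖b - d‖ := by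
  rw [show a * b - c * d = (a - c) * b + c * (b - d) by ring, ← norm_mul, ← norm_mul]
  exact norm_add_le _ _

/-- Two functions can be approximated by polynomials together with their products. -/
theorem exists_polynomials_near (f g : DirichletAlgebra) {ε : ℝ} (hε : 0 < ε) :
    ∃ p q : MvPolynomial ℕ ℂ,
      (∀ s, ‖f s * g s - DirichletAlgebra.ofPolynomial (p * q) s‖ ≤ ε) ∧
      ∀ z, ‖bohrLift f z * bohrLift g z - BallAlgebra.ofPolynomial (p * q) z‖ ≤ ε := by
  -- The bound `η ≤ 1` gives `‖p‖ ≤ ‖f‖ + 1`; the product error is then at most `η * (‖f‖ + ‖g‖ +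
  -- 1)`.
  set η := min 1 (ε / (‖f‖ + ‖g‖ + 1)) with hη
  have hη0 : 0 < η := by positivity
  obtain ⟨p, hp⟩ := f.exists_norm_sub_ofPolynomial_le hη0
  obtain ⟨q, hq⟩ := g.exists_norm_sub_ofPolynomial_le hη0
  have hηε : η * (‖f‖ + ‖g‖ + 1) ≤ ε := by
    rw [← le_div_iff₀ (by positivity)]
    exact min_le_right _ _
  have hpn : ‖DirichletAlgebra.ofPolynomial p‖ ≤ ‖f‖ + 1 := by
    have h1 := norm_le_norm_add_norm_sub' (DirichletAlgebra.ofPolynomial p) f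
    rw [norm_sub_rev] at h1
    linarith [min_le_left 1 (ε / (‖f‖ + ‖g‖ + 1))]
  have key : ∀ a b c d : ℂ, ‖a - c‖ ≤ η → ‖b‖ ≤ ‖g‖ → ‖c‖ ≤ ‖f‖ + 1 → ‖b - d‖ ≤ η →
      ‖a * b - c * d‖ ≤ ε := by
    intro a b c d h1 h2 h3 h4
    refine (norm_mul_sub_mul_le a b c d).trans ?_
    calc _ ≤ η * ‖g‖ + (‖f‖ + 1) * η := by gcongr
      _ = η * (‖f‖ + ‖g‖ + 1) := by ring
      _ ≤ ε := hηε
  have hlift : ∀ (h : DirichletAlgebra) (r : MvPolynomial ℕ ℂ) (z : BallC0),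
      ‖bohrLift h z - BallAlgebra.ofPolynomial r z‖ ≤ ‖h - DirichletAlgebra.ofPolynomial r‖ := by
    intro h r z
    rw [← bohrLift_ofPolynomial, ← BallAlgebra.sub_apply, ← map_sub, ← bohrLift.norm_map]
    exact BallAlgebra.norm_apply_le _ z
  refine ⟨p, q, fun s => ?_, fun z => ?_⟩
  · rw [DirichletAlgebra.ofPolynomial_apply, map_mul]
    exact key _ _ _ _ ((DirichletAlgebra.norm_apply_le (f - _) s).trans hp)
      (DirichletAlgebra.norm_apply_le g s)
      ((DirichletAlgebra.norm_apply_le (DirichletAlgebra.ofPolynomial p) s).trans hpn)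
      ((DirichletAlgebra.norm_apply_le (g - _) s).trans hq)
  · rw [BallAlgebra.ofPolynomial_apply, map_mul]
    refine key _ _ _ _ ((hlift f p z).trans hp) ?_ ?_ ((hlift g q z).trans hq)
    · exact (BallAlgebra.norm_apply_le _ z).trans (bohrLift.norm_map g).le
    · exact (BallAlgebra.norm_apply_le (BallAlgebra.ofPolynomial p) z).trans
        ((norm_ofPolynomial_eq p).le.trans hpn)

/-- The product is a uniform limit of polynomials, hence lies in the space. The lift of `h` and the
product of the lifts are both within `ε / 2` of the same polynomial `p * q`, for every `ε`. -/
theorem exists_mul (f g : DirichletAlgebra) : ∃ h : DirichletAlgebra,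
    (∀ s, h s = f s * g s) ∧ ∀ z, bohrLift h z = bohrLift f z * bohrLift g z := by
  obtain ⟨h, hh⟩ := DirichletAlgebra.exists_of_near (g := fun s => f s * g s) fun ε hε =>
    let ⟨p, q, hs, _⟩ := exists_polynomials_near f g hε
    ⟨_, hs⟩
  refine ⟨h, congrFun hh, fun z => eq_of_forall_dist_le fun ε hε => ?_⟩
  obtain ⟨p, q, hs, hz⟩ := exists_polynomials_near f g (half_pos hε)
  have h1 : ‖h - DirichletAlgebra.ofPolynomial (p * q)‖ ≤ ε / 2 :=
    DirichletAlgebra.norm_le fun s => by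
      rw [DirichletAlgebra.sub_apply, hh]
      exact hs s
  have h2 := BallAlgebra.norm_apply_le
    (bohrLift (h - DirichletAlgebra.ofPolynomial (p * q))) z
  rw [bohrLift.norm_map, map_sub, bohrLift_ofPolynomial, BallAlgebra.sub_apply] at h2
  have h3 := hz z
  rw [dist_eq_norm]
  calc _ = ‖(bohrLift h z - BallAlgebra.ofPolynomial (p * q) z) -
        (bohrLift f z * bohrLift g z - BallAlgebra.ofPolynomial (p * q) z)‖ := by congr 1; ring
    _ ≤ _ := norm_sub_le _ _
    _ ≤ ε := by linarith

end BohrLift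

theorem mainTheorem2 :
    ∃ Φ : BohrLift.DirichletAlgebra ≃ₗᵢ[ℂ] BohrLift.BallAlgebra,
      (∀ f g : BohrLift.DirichletAlgebra, ∃ h : BohrLift.DirichletAlgebra,
        (∀ s, h s = f s * g s) ∧ ∀ z, Φ h z = Φ f z * Φ g z) ∧
      ∀ α : ℕ →₀ ℕ, ∃ f : BohrLift.DirichletAlgebra,
        (∀ s : BohrLift.HalfPlane, f s = (BohrLift.primePow α : ℂ) ^ (-(s : ℂ))) ∧
        ∀ z, Φ f z = BohrLift.monomial α z := by
  refine ⟨BohrLift.bohrLift, BohrLift.exists_mul, fun α =>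
    ⟨BohrLift.DirichletAlgebra.ofPolynomial (MvPolynomial.monomial α 1), fun s => ?_, fun z => ?_⟩⟩
  · rw [BohrLift.DirichletAlgebra.ofPolynomial_apply, BohrLift.eval_monomial_primeVec, one_mul]
  · rw [BohrLift.bohrLift_ofPolynomial, BohrLift.BallAlgebra.ofPolynomial_apply,
      MvPolynomial.eval_monomial, one_mul]
    rfl
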